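/- Let $n\ge 3$, $k\ge 0$, and $\mu_1,\dots,\mu_n>0$. Let $\mathcal{C}\ell_n$ be the real Clifford algebra with generators $e_1,\dots,e_n$, $e_ie_j+e_je_i=-2\delta_{ij}$, and let $V$ be a real representation space of $\mathcal{C}\ell_n$ (a complex one is regarded as real). On $\mathbb{R}[x_1,\dots,x_n]\otimes V$ let $r_i$ be the reflection $x_i\mapsto -x_i$, let $T_i=\partial_{x_i}+\frac{\mu_i}{x_i}(1-r_i)$ be the Dunkl operators, and for $A\subset[n]=\{1,\dots,n\}$ put $$\underline{D}_A=\sum_{i\in A}e_iT_i,\qquad \underline{x}_A=\sum_{i\in A}e_ix_i,\qquad \Gamma_A=\tfrac12\big([\underline{x}_A,\underline{D}_A]-1\big)\prod_{i\in A}r_i .$$ For $\ell\in\{1,\dots,n-2\}$ define $$K_\ell^{\pm}=(\Gamma_{\{\ell+1,\ell+2\}}\pm\Gamma_{[\ell+2]\setminus\{\ell+1\}})(\Gamma_{[\ell+1]}\mp\tfrac12)-(\Gamma_{\{\ell+2\}}\pm\Gamma_{[\ell+2]})(\Gamma_{[\ell]}\pm\Gamma_{\{\ell+1\}}).$$ For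 $p$ homogeneous of degree $d$ in $x_1,\dots,x_{i-1}$ with values in $V$, its Cauchy--Kovalevskaia extension is $$\mathbf{CK}_{x_i}(p)=\sum_{l=0}^{\lfloor d/2\rfloor}\frac{\Gamma(\mu_i+\frac12)}{2^{2l}\,l!\,\Gamma(l+\mu_i+\frac12)}x_i^{2l}\underline{D}_{[i-1]}^{2l}p+\frac{e_ix_i\underline{D}_{[i-1]}}{2}\sum_{l=0}^{\lfloor (d-1)/2\rfloor}\frac{\Gamma(\mu_i+\frac12)}{2^{2l}\,l!\,\Gamma(l+\mu_i+\frac32)}x_i^{2l}\underline{D}_{[i-1]}^{2l}p .$$ A multi-index is $\mathbf{j}=(j_1,\dots,j_{n-2},j_{n-1})$ with integers $j_1,\dots,j_{n-2}$ and $j_{n-1}=k-\sum_{i\le n-2}j_i$ (so the last entry is determined by the others); it is admissible if all its entries are nonnegative. Write $|\mathbf{j}_\ell|=j_1+\dots+j_\ell$. For $v\in V$ and admissible $\mathbf{j}$ put $$\Psi_{\mathbf{j}}^{v}=\mathbf{CK}_{x_n}\Big[\underline{x}_{[n-1]}^{j_{n-1}}\,\mathbf{CK}_{x_{n-1}}\big[\underline{x}_{[n-2]}^{j_{n-2}}\cdots\mathbf{CK}_{x_3}[\underline{x}_{[2]}^{j_2}\,\mathbf{CK}_{x_2}[x_1^{j_1}v]]\cdots\big]\Big],$$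 and put $\Psi_{\mathbf{j}}^{v}=0$ if $\mathbf{j}$ is not admissible. If $(v_s)$ is a basis of $V$, the $\Psi_{\mathbf{j}}^s=\Psi_{\mathbf{j}}^{v_s}$ are the usual basis functions of the $V$-valued Dunkl monogenics of degree $k$. Let $h_\ell$ (for $\ell\le n-3$) be the vector with $1$ at position $\ell$, $-1$ at position $\ell+1$ and $0$ elsewhere, and let $\bar h_{n-2}$ be the vector with $1$ at position $n-2$ and $0$ at the other positions (adding it lowers $j_{n-1}$ by one, since $k$ is fixed). For $v\in V$ put $v^{(1)}=e_1v$ and $v^{(\ell)}=v$ for $\ell\ge 2$. Then for every admissible $\mathbf{j}$, every $\ell\in\{1,\dots,n-3\}$ and each choice of sign there is a nonzero real constant $c$ such that for all $v\in V$ $$K_\ell^{\pm}\Psi_{\mathbf{j}}^{v}=\begin{cases}c\,\Psi_{\mathbf{j}\pm h_\ell}^{v^{(\ell)}}&\text{if }|\mathbf{j}_\ell|\text{ is odd},\\ c\,\Psi_{\mathbf{j}\mp h_\ell}^{v^{(\ell)}}&\text{if }|\mathbf{j}_\ell|\text{ is even},\end{cases}$$ and for $\ell=n-2$ there is likewise a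 nonzero real constant $c$ such that for all $v\in V$ $$K_{n-2}^{\pm}\Psi_{\mathbf{j}}^{v}=\begin{cases}c\,\Psi_{\mathbf{j}\pm\bar h_{n-2}}^{v^{(n-2)}}&\text{if }|\mathbf{j}_{n-2}|\text{ is odd},\\ c\,\Psi_{\mathbf{j}\mp\bar h_{n-2}}^{v^{(n-2)}}&\text{if }|\mathbf{j}_{n-2}|\text{ is even}.\end{cases}$$ In particular, for $\ell\ge2$ the operator $K_\ell^\pm$ maps $\Psi_{\mathbf{j}}^s$ to a nonzero multiple of a single function $\Psi_{\mathbf{j}'}^{s}$ with the same $s$ (or to $0$ if $\mathbf{j}'$ is not admissible). -/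

import Mathlib

open MvPolynomial
open scoped TensorProduct

noncomputable section

namespace DiracDunkl

/-- The quadratic form `-(u₁² + ⋯ + uₙ²)` on `ℝⁿ`; its Clifford algebra is generated by
`e₁, …, eₙ` with `eᵢ eⱼ + eⱼ eᵢ = -2 δᵢⱼ`. -/
def cliffordForm (n : ℕ) : QuadraticForm ℝ (Fin n → ℝ) :=
  QuadraticMap.weightedSumSquares ℝ (fun _ : Fin n => (-1 : ℝ))

/-- The Clifford algebra `Cℓₙ` of negative signature. -/
abbrev Cl (n : ℕ) : Type := CliffordAlgebra (cliffordForm n)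

/-- The Clifford generator `eᵢ`. The index `i : Fin n` stands for the label `i + 1`. -/
def e {n : ℕ} (i : Fin n) : Cl n := CliffordAlgebra.ι (cliffordForm n) (Pi.single i 1)

/-! ### Operators on scalar polynomials -/

/-- The product of the reflections `r_i`, `i ∈ A`: it changes the sign of `x_i` for `i ∈ A`. -/
def reflPoly {n : ℕ} (A : Finset (Fin n)) :
    MvPolynomial (Fin n) ℝ →ₐ[ℝ] MvPolynomial (Fin n) ℝ :=
  aeval (fun m => if m ∈ A then -X m else X m)

/-- The Dunkl operator `T_i = ∂_i + (μ_i / x_i) (1 - r_i)` on polynomials. The quotient is exact,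
since `p - r_i p` is divisible by `x_i`. -/
def dunklT {n : ℕ} (μ : Fin n → ℝ) (i : Fin n) :
    MvPolynomial (Fin n) ℝ →ₗ[ℝ] MvPolynomial (Fin n) ℝ where
  toFun p := pderiv i p + μ i • ((p - reflPoly {i} p).divMonomial (Finsupp.single i 1))
  map_add' p q := by
    rw [map_add, map_add, add_sub_add_comm, add_divMonomial, smul_add]
    abel
  map_smul' c p := by
    have h : ∀ q : MvPolynomial (Fin n) ℝ,
        (c • q).divMonomial (Finsupp.single i 1) = c • (q.divMonomial (Finsupp.single i 1)) := by
      intro q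
      ext s
      simp [coeff_divMonomial]
    simp only [map_smul, RingHom.id_apply]
    rw [← smul_sub, h, smul_add, smul_comm, Derivation.map_smul]

/-- The division in `dunklT` is exact. -/
theorem X_mul_divMonomial_sub_reflPoly {n : ℕ} (i : Fin n) (p : MvPolynomial (Fin n) ℝ) :
    X i * ((p - reflPoly {i} p).divMonomial (Finsupp.single i 1)) = p - reflPoly {i} p := by
  have h : (X i : MvPolynomial (Fin n) ℝ) ∣ p - reflPoly {i} p := by
    induction p using MvPolynomial.induction_on with
    | C a => simp [reflPoly]
    | add p q hp hq =>
      rw [map_add, add_sub_add_comm]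
      exact dvd_add hp hq
    | mul_X p m hp =>
      rw [map_mul]
      by_cases hm : m = i
      · subst hm
        have : reflPoly {m} (X m : MvPolynomial (Fin n) ℝ) = -X m := by simp [reflPoly]
        rw [this]
        exact ⟨p + reflPoly {m} p, by ring⟩
      · have : reflPoly {i} (X m : MvPolynomial (Fin n) ℝ) = X m := by simp [reflPoly, hm]
        rw [this, ← sub_mul]
        exact Dvd.dvd.mul_right hp _
  obtain ⟨q, hq⟩ := h
  rw [hq]
  congr 1
  exact X_mul_divMonomial i q

/-! ### Operators on `V`-valued polynomials -/

section Operators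

variable {n : ℕ} (V : Type*) [AddCommGroup V] [Module ℝ V] [Module (Cl n) V]
  [IsScalarTower ℝ (Cl n) V]

/-- The `V`-valued polynomials `𝒫(ℝⁿ) ⊗ V`. -/
abbrev VPoly (n : ℕ) (V : Type*) [AddCommGroup V] [Module ℝ V] :=
  MvPolynomial (Fin n) ℝ ⊗[ℝ] V

/-- The action of `e_i` on `V`-valued polynomials (on the values). -/
def opE (i : Fin n) : Module.End ℝ (VPoly n V) :=
  (DistribSMul.toLinearMap ℝ V (e i)).lTensor (MvPolynomial (Fin n) ℝ)

/-- Multiplication by `x_i`. -/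
def opX (i : Fin n) : Module.End ℝ (VPoly n V) :=
  (LinearMap.mulLeft ℝ (X i : MvPolynomial (Fin n) ℝ)).rTensor V

/-- The Dunkl operator `T_i`. -/
def opT (μ : Fin n → ℝ) (i : Fin n) : Module.End ℝ (VPoly n V) :=
  (dunklT μ i).rTensor V

/-- The product of reflections `∏_{i ∈ A} r_i`. -/
def opR (A : Finset (Fin n)) : Module.End ℝ (VPoly n V) :=
  (reflPoly A).toLinearMap.rTensor V

/-- The intermediate Dirac-Dunkl operator `D_A = ∑_{i ∈ A} e_i T_i`. -/
def dirac (μ : Fin n → ℝ) (A : Finset (Fin n)) : Module.End ℝ (VPoly n V) :=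
  ∑ i ∈ A, opE V i * opT V μ i

/-- The intermediate position operator `x_A = ∑_{i ∈ A} e_i x_i`. -/
def position (A : Finset (Fin n)) : Module.End ℝ (VPoly n V) :=
  ∑ i ∈ A, opE V i * opX V i

/-- The sCasimir operator `S_A = ([x_A, D_A] - 1) / 2`. -/
def sCasimir (μ : Fin n → ℝ) (A : Finset (Fin n)) : Module.End ℝ (VPoly n V) :=
  (1 / 2 : ℝ) • (position V A * dirac V μ A - dirac V μ A * position V A - 1)

/-- The intermediate spherical Dirac-Dunkl operator `Γ_A = S_A ∏_{i ∈ A} r_i`. -/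
def Gam (μ : Fin n → ℝ) (A : Finset (Fin n)) : Module.End ℝ (VPoly n V) :=
  sCasimir V μ A * opR V A

/-- The subset of `{1, …, n}` with a given set of labels. -/
def lab (n : ℕ) (s : Finset ℕ) : Finset (Fin n) :=
  Finset.univ.filter (fun i => (i : ℕ) + 1 ∈ s)

/-- The operators `K_ℓ^±` (`ℓ` is counted from `1`, and `ε = ±1` is the sign):
`(Γ_{ℓ+1,ℓ+2} ± Γ_{[ℓ+2]∖{ℓ+1}}) (Γ_[ℓ+1] ∓ 1/2) - (Γ_{ℓ+2} ± Γ_[ℓ+2]) (Γ_[ℓ] ± Γ_{ℓ+1})`. -/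
def K (μ : Fin n → ℝ) (ε : ℤˣ) (ℓ : ℕ) : Module.End ℝ (VPoly n V) :=
  (Gam V μ (lab n {ℓ + 1, ℓ + 2})
      + ((ε : ℤ) : ℝ) • Gam V μ (lab n (Finset.Icc 1 (ℓ + 2) \ {ℓ + 1})))
    * (Gam V μ (lab n (Finset.Icc 1 (ℓ + 1))) - (((ε : ℤ) : ℝ) / 2) • 1)
  - (Gam V μ (lab n {ℓ + 2}) + ((ε : ℤ) : ℝ) • Gam V μ (lab n (Finset.Icc 1 (ℓ + 2))))
    * (Gam V μ (lab n (Finset.Icc 1 ℓ)) + ((ε : ℤ) : ℝ) • Gam V μ (lab n {ℓ + 1}))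

/-- The Cauchy-Kovalevskaia extension in the variable `x_i` of a `V`-valued polynomial that is
homogeneous of degree `k` in the variables preceding `x_i`; `D` is the Dirac-Dunkl operator in
these preceding variables. -/
def CK (μ : Fin n → ℝ) (i : Fin n) (k : ℕ) : Module.End ℝ (VPoly n V) :=
  let D := dirac V μ (Finset.Iio i)
  ∑ l ∈ Finset.range (k / 2 + 1),
      (Real.Gamma (μ i + 1 / 2) / (2 ^ (2 * l) * l.factorial * Real.Gamma (l + μ i + 1 / 2))) •
        (opX V i ^ (2 * l) * D ^ (2 * l))
  + (1 / 2 : ℝ) • (opE V i * opX V i * D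
      * ∑ l ∈ Finset.range ((k + 1) / 2),
          (Real.Gamma (μ i + 1 / 2) /
              (2 ^ (2 * l) * l.factorial * Real.Gamma (l + μ i + 3 / 2))) •
            (opX V i ^ (2 * l) * D ^ (2 * l)))

variable {V} in
/-- The tower of extensions with exponents `a 0 = j₁`, `a 1 = j₂`, …; its stage `m` is a
polynomial in the first `m + 1` variables:
`x₁^{j₁} v`, `CK_{x₂}[x₁^{j₁}] v`, `CK_{x₃}[x_{[2]}^{j₂} CK_{x₂}[x₁^{j₁}]] v`, and so on. -/
def tower (μ : Fin n → ℝ) (a : ℕ → ℕ) (v : V) : (m : ℕ) → m < n → VPoly n V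
  | 0, h => (X ⟨0, h⟩ ^ a 0) ⊗ₜ[ℝ] v
  | 1, h => CK V μ ⟨1, h⟩ (a 0) (tower μ a v 0 (by omega))
  | m + 2, h =>
      CK V μ ⟨m + 2, h⟩ (∑ i ∈ Finset.range (m + 2), a i)
        ((position V (Finset.Iio ⟨m + 2, h⟩) ^ a (m + 1)) (tower μ a v (m + 1) (by omega)))

end Operators

/-! ### Multi-indices and basis functions -/

/-- A multi-index is given by its free entries `j₁, …, j_{n-2}` (`j i` is `j_{i+1}`); the last one
is `j_{n-1} = k - (j₁ + ⋯ + j_{n-2})`. It is admissible if all `n - 1` entries are nonnegative. -/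
def Admissible {n : ℕ} (k : ℕ) (j : Fin (n - 2) → ℤ) : Prop :=
  (∀ i, 0 ≤ j i) ∧ ∑ i, j i ≤ k

/-- All the entries of the multi-index: `entries k j i` is `j_{i+1}` for `i + 1 ≤ n - 1`. -/
def entries {n : ℕ} (k : ℕ) (j : Fin (n - 2) → ℤ) (i : ℕ) : ℕ :=
  if h : i < n - 2 then (j ⟨i, h⟩).toNat else (k - ∑ m, j m).toNat

/-- `|j_ℓ| = j₁ + ⋯ + j_ℓ` for `ℓ ≤ n - 2`. -/
def partialSum {n : ℕ} (j : Fin (n - 2) → ℤ) (ℓ : ℕ) : ℤ :=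
  ∑ i ∈ Finset.univ.filter (fun i : Fin (n - 2) => (i : ℕ) < ℓ), j i

open Classical in
/-- The function `Ψ_j^v` of degree `k`, the top of the tower of extensions started at `x₁^{j₁} v`;
it is `0` by convention if `j` is not admissible. For `v = v_s` in a basis of `V` this is the basis
function `Ψ_j^s`. -/
def Psi {n : ℕ} {V : Type*} [AddCommGroup V] [Module ℝ V] [Module (Cl n) V]
    [IsScalarTower ℝ (Cl n) V] (hn : 3 ≤ n) (μ : Fin n → ℝ) (k : ℕ) (j : Fin (n - 2) → ℤ)
    (v : V) : VPoly n V :=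
  if Admissible k j then tower μ (entries k j) v (n - 1) (by omega) else 0

/-- The vector `h_ℓ` with `1` at position `ℓ` and `-1` at position `ℓ + 1` (free entries). -/
def hvec (n ℓ : ℕ) : Fin (n - 2) → ℤ :=
  fun i => if (i : ℕ) + 1 = ℓ then 1 else if (i : ℕ) + 1 = ℓ + 1 then -1 else 0

/-- The vector `h̄_{n-2}` with `1` at position `n - 2` (free entries). -/
def hbar (n : ℕ) : Fin (n - 2) → ℤ :=
  fun i => if (i : ℕ) + 1 = n - 2 then 1 else 0

/-- The vector that labels the image under `K_ℓ^±`: it is `e₁ v` for `ℓ = 1`, and `v` otherwise. -/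
def twist {n : ℕ} {V : Type*} [AddCommGroup V] [Module (Cl n) V] (hn : 3 ≤ n) (ℓ : ℕ) (v : V) : V :=
  if ℓ = 1 then e (⟨0, by omega⟩ : Fin n) • v else v

end DiracDunkl

end

/-! The operator `K` sees only three blocks of variables: `B = {x_1, …, x_ℓ}`, `x_i` with `i = ℓ+1`,
and `x_k` with `k = ℓ+2`. Let `M` be the stage of the tower on `B`, a monogenic of weight `g` (its
degree plus the sum of the `μ + 1/2`) and parity `δ = ±1`. Put `q_j = CK_{x_i}[x_B^j M]` and
`F_{j,l} = CK_{x_k}[x_{B∪i}^l q_j]`. A Cauchy-Kovalevskaia extension is the unique polynomial in the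
kernel of the larger Dirac operator with the given restriction to the hyperplane (`opZ_CK`,
`dirac_CK`, `eq_of_dirac_insert`), so identities between monogenics need only be checked on that
hyperplane.

By the `osp(1|2)` relations, `Γ_A` commutes with `D_C` and `x_C` whenever `A ⊆ C`. Hence `K F_{j,l}`
is monogenic and determined by its restriction to `x_k = 0`, and a relation `K F_{j,l} = c
F_{j',l'}` passes unchanged to all later stages of the tower (`cliffordTower_propagate`).

For fixed `j + l` the polynomials `x_{B∪i}^l q_j` share the eigenvalue of `Γ_B` and the parity `σ =
δ(-1)^(j+l)`, while `Γ_{B∪i}` acts by `λ_j = δ(-1)^j (g + j + μ_i)`. The anticommutator of `Γ_{B∪i}`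
with `r_i` (`Gam_mul_opR_add`) yields a combination `ladder` of `r_i` and `1` that exchanges the
eigenvalues `λ` and `σ - λ`. Now `σ - λ_j` is `λ_{j-1}` for even `l` and `λ_{j+1}` for odd `l`.
Eigenvectors of `Γ_{B∪i}` are determined by their restriction to `x_i = 0`
(`eq_zero_of_Gam_insert`), so the image is a multiple of one neighbour, and the factor is read off
at `x_i = 0`, where all these polynomials become `x_B^(j+l) M`.

Write `p` for the restriction of `F_{j,l}` to `x_k = 0`. Then `K^ε F_{j,l}` restricts to a multiple
of `ladder p` if `ε = σ`, and to `x_{B∪i} (ladder (D p))` if `ε = -σ` (`opZ_blockK_pos`,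
`opZ_blockK_neg`). In both cases the sign of `λ_j` lowers `j` and the opposite sign raises it.
Positivity of the `μ_i` makes the factors nonzero, except when lowering at `j = 0` or raising at `l
= 0`, where the image is zero. Starting the tower from `(e_1 x_1)^{j_1}` instead of `x_1^{j_1}`
makes `ℓ = 1` uniform with the rest; undoing this produces the factor `e_1` of `twist`. -/

noncomputable section

namespace DiracDunkl

set_option linter.unusedSectionVars false

section Scalar

/-! ### Coefficients of the scalar operators -/

/-- The Dunkl integer `m + μ (1 - (-1)^m)`. -/
def dunklNat (μ : ℝ) (m : ℕ) : ℝ := m + μ * (1 - (-1) ^ m)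

theorem dunklNat_zero (μ : ℝ) : dunklNat μ 0 = 0 := by simp [dunklNat]

theorem dunklNat_succ (μ : ℝ) (m : ℕ) :
    dunklNat μ (m + 1) = dunklNat μ m + 1 + 2 * μ * (-1) ^ m := by
  simp only [dunklNat, pow_succ]; push_cast; ring

theorem dunklNat_succ_pos {μ : ℝ} (hμ : 0 < μ) (m : ℕ) : 0 < dunklNat μ (m + 1) := by
  have h : (0 : ℝ) ≤ 1 - (-1) ^ (m + 1) := by
    rcases neg_one_pow_eq_or ℝ (m + 1) with h | h <;> rw [h] <;> norm_num
  have : (0 : ℝ) ≤ m := Nat.cast_nonneg m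
  have := mul_nonneg hμ.le h
  simp only [dunklNat]; push_cast; linarith

variable {n : ℕ}

/-- The restriction to `x_i = 0` of scalar polynomials. -/
def restrictPoly (i : Fin n) : MvPolynomial (Fin n) ℝ →ₐ[ℝ] MvPolynomial (Fin n) ℝ :=
  aeval (fun m => if m = i then 0 else X m)

theorem reflPoly_monomial (A : Finset (Fin n)) (t : Fin n →₀ ℕ) (c : ℝ) :
    reflPoly A (monomial t c) = monomial t ((∏ i ∈ A, (-1) ^ t i) * c) := by
  have h : ∀ (i : Fin n) (k : ℕ), (if i ∈ A then -X i else X i : MvPolynomial (Fin n) ℝ) ^ k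
      = C (if i ∈ A then (-1) ^ k else 1) * X i ^ k := by
    intro i k
    split_ifs
    · rw [neg_pow]; simp
    · simp
  rw [reflPoly, aeval_monomial]
  simp only [h]
  rw [Finsupp.prod_mul, monomial_eq, Finsupp.prod_fintype _ _ (by simp), ← map_prod,
    Finset.prod_ite_mem, Finset.univ_inter, algebraMap_eq, C_mul]
  ring

theorem coeff_reflPoly (A : Finset (Fin n)) (s : Fin n →₀ ℕ) (p : MvPolynomial (Fin n) ℝ) :
    coeff s (reflPoly A p) = (∏ i ∈ A, (-1) ^ s i) * coeff s p := by
  induction p using MvPolynomial.induction_on' with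
  | monomial t c =>
    rw [reflPoly_monomial, coeff_monomial, coeff_monomial]
    split_ifs with h
    · rw [h]
    · simp
  | add p q hp hq => rw [map_add, coeff_add, hp, hq, coeff_add]; ring

theorem restrictPoly_monomial (i : Fin n) (t : Fin n →₀ ℕ) (c : ℝ) :
    restrictPoly i (monomial t c) = if t i = 0 then monomial t c else 0 := by
  rw [restrictPoly, aeval_monomial]
  split_ifs with h
  · rw [monomial_eq, algebraMap_eq]
    congr 1
    refine Finsupp.prod_congr fun m hm => ?_
    rw [if_neg]
    rintro rfl
    exact (Finsupp.mem_support_iff.mp hm) h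
  · rw [Finsupp.prod, Finset.prod_eq_zero (Finsupp.mem_support_iff.mpr h), mul_zero]
    rw [if_pos rfl, zero_pow h]

theorem coeff_restrictPoly (i : Fin n) (s : Fin n →₀ ℕ) (p : MvPolynomial (Fin n) ℝ) :
    coeff s (restrictPoly i p) = if s i = 0 then coeff s p else 0 := by
  induction p using MvPolynomial.induction_on' with
  | monomial t c =>
    rw [restrictPoly_monomial]
    by_cases hts : t = s
    · subst hts; split_ifs <;> simp
    · split_ifs <;> simp [coeff_monomial, hts]
  | add p q hp hq => rw [map_add, coeff_add, hp, hq, coeff_add]; split_ifs <;> simp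

theorem coeff_dunklT (μ : Fin n → ℝ) (i : Fin n) (s : Fin n →₀ ℕ) (p : MvPolynomial (Fin n) ℝ) :
    coeff s (dunklT μ i p)
      = dunklNat (μ i) (s i + 1) * coeff (s + Finsupp.single i 1) p := by
  change coeff s (pderiv i p + μ i • ((p - reflPoly {i} p).divMonomial (Finsupp.single i 1))) = _
  rw [coeff_add, coeff_smul, coeff_divMonomial, coeff_sub, coeff_reflPoly, coeff_pderiv,
    add_comm (Finsupp.single i 1) s]
  simp [dunklNat]
  ring

theorem coeff_mulX (i : Fin n) (s : Fin n →₀ ℕ) (p : MvPolynomial (Fin n) ℝ) :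
    coeff s (X i * p) = if s i = 0 then 0 else coeff (s - Finsupp.single i 1) p := by
  rw [coeff_X_mul']
  simp only [Finsupp.mem_support_iff]
  split_ifs <;> simp_all

/-! ### Relations between the scalar operators -/

theorem dunklT_comm (μ : Fin n → ℝ) (i j : Fin n) :
    dunklT μ i ∘ₗ dunklT μ j = dunklT μ j ∘ₗ dunklT μ i := by
  ext1 s; ext1; ext m
  simp only [LinearMap.comp_apply, coeff_dunklT]
  by_cases h : i = j
  · rw [h]
  · simp [h, Ne.symm h, add_right_comm]
    ring

theorem dunklT_mulX_of_ne (μ : Fin n → ℝ) {i j : Fin n} (h : i ≠ j) :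
    dunklT μ i ∘ₗ LinearMap.mulLeft ℝ (X j) = LinearMap.mulLeft ℝ (X j) ∘ₗ dunklT μ i := by
  apply LinearMap.ext; intro p; ext m
  simp only [LinearMap.comp_apply, LinearMap.mulLeft_apply, coeff_dunklT, coeff_mulX]
  have e1 : (m + Finsupp.single i 1 : Fin n →₀ ℕ) j = m j := by simp [h]
  have e2 : (m - Finsupp.single j 1 : Fin n →₀ ℕ) i = m i := by simp [h]
  rw [e1, e2]
  split_ifs with hm
  · simp
  · congr 2
    ext t
    simp only [Finsupp.coe_tsub, Finsupp.coe_add, Pi.sub_apply, Pi.add_apply, Finsupp.single_apply]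
    split_ifs with h1 h2
    · exact absurd (h1.trans h2.symm) h
    all_goals omega

theorem dunklT_mulX_self (μ : Fin n → ℝ) (i : Fin n) :
    dunklT μ i ∘ₗ LinearMap.mulLeft ℝ (X i)
      = LinearMap.mulLeft ℝ (X i) ∘ₗ dunklT μ i + LinearMap.id
        + (2 * μ i) • (reflPoly {i}).toLinearMap := by
  apply LinearMap.ext; intro p; ext m
  simp only [LinearMap.comp_apply, LinearMap.mulLeft_apply, coeff_dunklT, coeff_mulX,
    LinearMap.add_apply, LinearMap.smul_apply, coeff_add, coeff_smul, AlgHom.toLinearMap_apply,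
    coeff_reflPoly, LinearMap.id_apply, Finset.prod_singleton, smul_eq_mul]
  rw [if_neg (by simp), add_tsub_cancel_right]
  split_ifs with h
  · rw [h]; simp [dunklNat]; ring
  · have e1 : (m - Finsupp.single i 1 : Fin n →₀ ℕ) i + 1 = m i := by simp; omega
    have e2 : m - Finsupp.single i 1 + Finsupp.single i 1 = m :=
      tsub_add_cancel_of_le (Finsupp.single_le_iff.mpr (by omega))
    rw [e1, e2, dunklNat_succ]; ring

theorem reflPoly_mulX (A : Finset (Fin n)) (i : Fin n) :
    (reflPoly A).toLinearMap ∘ₗ LinearMap.mulLeft ℝ (X i)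
      = (if i ∈ A then (-1 : ℝ) else 1) •
        (LinearMap.mulLeft ℝ (X i) ∘ₗ (reflPoly A).toLinearMap) := by
  apply LinearMap.ext; intro p
  have : reflPoly A (X i) = (if i ∈ A then (-1 : ℝ) else 1) • X i := by
    simp only [reflPoly, aeval_X]; split_ifs <;> simp
  split_ifs at this ⊢ <;> simp [this]

theorem prod_neg_one_pow_add_single (A : Finset (Fin n)) (m : Fin n →₀ ℕ) (i : Fin n) :
    ∏ t ∈ A, (-1 : ℝ) ^ ((m + Finsupp.single i 1 : Fin n →₀ ℕ) t)
      = (if i ∈ A then (-1 : ℝ) else 1) * ∏ t ∈ A, (-1 : ℝ) ^ m t := by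
  simp only [Finsupp.coe_add, Pi.add_apply, pow_add, Finset.prod_mul_distrib]
  rw [mul_comm]
  congr 1
  simp [Finsupp.single_apply, pow_ite, Finset.prod_ite_eq]

theorem reflPoly_dunklT (μ : Fin n → ℝ) (A : Finset (Fin n)) (i : Fin n) :
    (reflPoly A).toLinearMap ∘ₗ dunklT μ i
      = (if i ∈ A then (-1 : ℝ) else 1) • (dunklT μ i ∘ₗ (reflPoly A).toLinearMap) := by
  apply LinearMap.ext; intro p; ext m
  simp only [LinearMap.comp_apply, AlgHom.toLinearMap_apply, coeff_reflPoly, coeff_dunklT,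
    LinearMap.smul_apply, coeff_smul, prod_neg_one_pow_add_single, smul_eq_mul]
  split_ifs <;> ring

theorem reflPoly_comp_of_disjoint {A B : Finset (Fin n)} (h : Disjoint A B) :
    (reflPoly A).toLinearMap ∘ₗ (reflPoly B).toLinearMap = (reflPoly (A ∪ B)).toLinearMap := by
  apply LinearMap.ext; intro p; ext m
  simp [coeff_reflPoly, Finset.prod_union h, mul_assoc]

theorem reflPoly_comp_self (A : Finset (Fin n)) :
    (reflPoly A).toLinearMap ∘ₗ (reflPoly A).toLinearMap = LinearMap.id := by
  apply LinearMap.ext; intro p; ext m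
  simp only [LinearMap.comp_apply, AlgHom.toLinearMap_apply, coeff_reflPoly, ← mul_assoc,
    ← Finset.prod_mul_distrib, LinearMap.id_apply, ← pow_add, Even.neg_one_pow ⟨_, rfl⟩]
  simp

theorem restrictPoly_mulX_self (i : Fin n) :
    (restrictPoly i).toLinearMap ∘ₗ LinearMap.mulLeft ℝ (X i) = 0 := by
  apply LinearMap.ext; intro p
  simp [restrictPoly]

theorem restrictPoly_mulX_of_ne {i j : Fin n} (h : j ≠ i) :
    (restrictPoly i).toLinearMap ∘ₗ LinearMap.mulLeft ℝ (X j)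
      = LinearMap.mulLeft ℝ (X j) ∘ₗ (restrictPoly i).toLinearMap := by
  apply LinearMap.ext; intro p
  simp [restrictPoly, h]

theorem restrictPoly_dunklT_of_ne (μ : Fin n → ℝ) {i j : Fin n} (h : j ≠ i) :
    (restrictPoly i).toLinearMap ∘ₗ dunklT μ j = dunklT μ j ∘ₗ (restrictPoly i).toLinearMap := by
  apply LinearMap.ext; intro p; ext m
  simp only [LinearMap.comp_apply, AlgHom.toLinearMap_apply, coeff_restrictPoly, coeff_dunklT]
  simp [h]

theorem dunklT_restrictPoly (μ : Fin n → ℝ) (i : Fin n) :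
    dunklT μ i ∘ₗ (restrictPoly i).toLinearMap = 0 := by
  apply LinearMap.ext; intro p; ext m
  simp [coeff_restrictPoly, coeff_dunklT]

theorem restrictPoly_comm (i j : Fin n) :
    (restrictPoly i).toLinearMap ∘ₗ (restrictPoly j).toLinearMap
      = (restrictPoly j).toLinearMap ∘ₗ (restrictPoly i).toLinearMap := by
  apply LinearMap.ext; intro p; ext m
  simp only [LinearMap.comp_apply, AlgHom.toLinearMap_apply, coeff_restrictPoly]
  split_ifs <;> rfl

theorem restrictPoly_reflPoly (i : Fin n) (A : Finset (Fin n)) :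
    (restrictPoly i).toLinearMap ∘ₗ (reflPoly A).toLinearMap
      = (reflPoly A).toLinearMap ∘ₗ (restrictPoly i).toLinearMap := by
  apply LinearMap.ext; intro p; ext m
  simp [coeff_restrictPoly, coeff_reflPoly]

theorem reflPoly_restrictPoly_self (i : Fin n) :
    (reflPoly {i}).toLinearMap ∘ₗ (restrictPoly i).toLinearMap = (restrictPoly i).toLinearMap := by
  apply LinearMap.ext; intro p; ext m
  simp only [LinearMap.comp_apply, AlgHom.toLinearMap_apply, coeff_restrictPoly, coeff_reflPoly,
    Finset.prod_singleton]
  split_ifs with h <;> simp [h]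

/-! ### Recovering a polynomial from its iterated Dunkl derivatives on a hyperplane. -/

theorem coeff_dunklT_pow (μ : Fin n → ℝ) (i : Fin n) (b : ℕ) (s : Fin n →₀ ℕ)
    (p : MvPolynomial (Fin n) ℝ) :
    coeff s ((dunklT μ i ^ b) p)
      = (∏ t ∈ Finset.range b, dunklNat (μ i) (s i + t + 1))
        * coeff (s + Finsupp.single i b) p := by
  induction b generalizing p with
  | zero => simp
  | succ b ih =>
    rw [pow_succ, Module.End.mul_apply, ih, coeff_dunklT, Finset.prod_range_succ, add_assoc s,
      ← Finsupp.single_add]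
    simp
    ring

/-- A polynomial is determined by the restrictions to `x_i = 0` of its iterated images under
the Dunkl operator `T_i`. -/
theorem eq_zero_of_restrictPoly_dunklT_pow {μ : Fin n → ℝ} {i : Fin n} (hμ : 0 < μ i)
    {p : MvPolynomial (Fin n) ℝ} (h : ∀ b, restrictPoly i ((dunklT μ i ^ b) p) = 0) : p = 0 := by
  ext s
  -- Applying `T_i` exactly `s i` times moves the coefficient at `s` onto a monomial without `x_i`,
  -- up to a product of positive Dunkl integers.
  have h1 := congrArg (coeff (s.erase i)) (h (s i))
  rw [coeff_restrictPoly, if_pos (by simp), coeff_dunklT_pow, coeff_zero, mul_eq_zero] at h1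
  rw [coeff_zero]
  rcases h1 with h1 | h1
  · exact absurd h1 (Finset.prod_pos fun t _ => dunklNat_succ_pos hμ _).ne'
  · rwa [Finsupp.erase_add_single] at h1

end Scalar

/-! ### Relations between the operators on vector-valued polynomials -/

theorem e_mul_self {n : ℕ} (i : Fin n) : (e i : Cl n) * e i = -1 := by
  rw [e, CliffordAlgebra.ι_sq_scalar]
  have : cliffordForm n (Pi.single i 1) = -1 := by
    simp [cliffordForm, QuadraticMap.weightedSumSquares_apply, Pi.single_apply]
  rw [this]; simp

theorem e_mul_e_of_ne {n : ℕ} {i j : Fin n} (h : i ≠ j) : (e i : Cl n) * e j = -(e j * e i) := by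
  rw [eq_neg_iff_add_eq_zero, e, e, CliffordAlgebra.ι_mul_ι_add_swap]
  have : QuadraticMap.polar (cliffordForm n) (Pi.single i 1) (Pi.single j 1) = 0 := by
    simp only [QuadraticMap.polar, cliffordForm, QuadraticMap.weightedSumSquares_apply,
      ← Finset.sum_sub_distrib]
    refine Finset.sum_eq_zero fun t _ => ?_
    simp only [Pi.add_apply, Pi.single_apply]
    split_ifs with h1 h2
    · exact absurd (h1.symm.trans h2) h
    all_goals simp
  rw [this, map_zero]

/-- Products of two commuting scalar operators with anticommuting Clifford factors. -/
theorem mul_mul_mul_of_commute {R : Type*} [Ring R] {a b x y : R} (hab : a * b = -(b * a))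
    (hxb : Commute b x) (hya : Commute a y) (hxy : Commute x y) :
    a * x * (b * y) = -(b * y * (a * x)) := by
  calc a * x * (b * y) = a * (x * b) * y := by noncomm_ring
    _ = a * b * (x * y) := by rw [← hxb.eq]; noncomm_ring
    _ = -(b * (a * y) * x) := by rw [hab, hxy.eq]; noncomm_ring
    _ = -(b * y * (a * x)) := by rw [hya.eq]; noncomm_ring

section Operators

variable {n : ℕ} (V : Type*) [AddCommGroup V] [Module ℝ V] [Module (Cl n) V]
  [IsScalarTower ℝ (Cl n) V]

/-- The ring structure on the operators, as a shortcut for instance search. -/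
instance instRingEndVPoly : Ring (Module.End ℝ (VPoly n V)) := Module.End.instRing

/-- The restriction to `x_i = 0` of vector-valued polynomials. -/
def opZ (i : Fin n) : Module.End ℝ (VPoly n V) := (restrictPoly i).toLinearMap.rTensor V

theorem opE_mul_self (i : Fin n) : opE V i * opE V i = -1 := by
  rw [opE, ← LinearMap.lTensor_mul]
  have : DistribSMul.toLinearMap ℝ V (e i : Cl n) * DistribSMul.toLinearMap ℝ V (e i : Cl n)
      = -1 := by
    ext v
    simp [← mul_smul, e_mul_self]
  rw [this, LinearMap.lTensor_neg]
  congr 1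
  exact LinearMap.lTensor_id _ _

theorem opE_mul_opE_of_ne {i j : Fin n} (h : i ≠ j) :
    opE V i * opE V j = -(opE V j * opE V i) := by
  rw [opE, opE, ← LinearMap.lTensor_mul, ← LinearMap.lTensor_mul, ← LinearMap.lTensor_neg]
  congr 1
  ext v
  simp [← mul_smul, e_mul_e_of_ne h]

theorem opE_commute_rTensor (i : Fin n) (f : Module.End ℝ (MvPolynomial (Fin n) ℝ)) :
    Commute (opE V i) (f.rTensor V) := by
  change opE V i ∘ₗ f.rTensor V = f.rTensor V ∘ₗ opE V i
  rw [opE, LinearMap.lTensor_comp_rTensor, LinearMap.rTensor_comp_lTensor]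

theorem opE_opX (i j : Fin n) : Commute (opE V i) (opX V j) := opE_commute_rTensor V i _
theorem opE_opT (μ : Fin n → ℝ) (i j : Fin n) : Commute (opE V i) (opT V μ j) :=
  opE_commute_rTensor V i _
theorem opE_opR (i : Fin n) (A : Finset (Fin n)) : Commute (opE V i) (opR V A) :=
  opE_commute_rTensor V i _
theorem opE_opZ (i j : Fin n) : Commute (opE V i) (opZ V j) := opE_commute_rTensor V i _

theorem opX_comm (i j : Fin n) : Commute (opX V i) (opX V j) := by
  change _ = _
  rw [opX, opX, ← LinearMap.rTensor_mul, ← LinearMap.rTensor_mul]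
  congr 1
  apply LinearMap.ext; intro p
  simp [mul_left_comm]

theorem opT_comm (μ : Fin n → ℝ) (i j : Fin n) : Commute (opT V μ i) (opT V μ j) := by
  change _ = _
  rw [opT, opT, ← LinearMap.rTensor_mul, ← LinearMap.rTensor_mul]
  exact congrArg _ (dunklT_comm μ i j)

theorem opT_opX_of_ne (μ : Fin n → ℝ) {i j : Fin n} (h : i ≠ j) :
    Commute (opT V μ i) (opX V j) := by
  change _ = _
  rw [opT, opX, ← LinearMap.rTensor_mul, ← LinearMap.rTensor_mul]
  exact congrArg _ (dunklT_mulX_of_ne μ h)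

theorem opT_opX_self (μ : Fin n → ℝ) (i : Fin n) :
    opT V μ i * opX V i = opX V i * opT V μ i + 1 + (2 * μ i) • opR V {i} := by
  have h := congrArg (LinearMap.rTensor V) (dunklT_mulX_self μ i)
  rw [LinearMap.rTensor_add, LinearMap.rTensor_add, LinearMap.rTensor_smul, LinearMap.rTensor_comp,
    LinearMap.rTensor_comp, LinearMap.rTensor_id] at h
  exact h

theorem opR_opX (A : Finset (Fin n)) (i : Fin n) :
    opR V A * opX V i = (if i ∈ A then (-1 : ℝ) else 1) • (opX V i * opR V A) := by
  have h := congrArg (LinearMap.rTensor V) (reflPoly_mulX A i)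
  rwa [LinearMap.rTensor_smul, LinearMap.rTensor_comp, LinearMap.rTensor_comp] at h

theorem opR_opT (μ : Fin n → ℝ) (A : Finset (Fin n)) (i : Fin n) :
    opR V A * opT V μ i = (if i ∈ A then (-1 : ℝ) else 1) • (opT V μ i * opR V A) := by
  have h := congrArg (LinearMap.rTensor V) (reflPoly_dunklT μ A i)
  rwa [LinearMap.rTensor_smul, LinearMap.rTensor_comp, LinearMap.rTensor_comp] at h

theorem opR_mul_opR_of_disjoint {A B : Finset (Fin n)} (h : Disjoint A B) :
    opR V A * opR V B = opR V (A ∪ B) := by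
  rw [opR, opR, ← LinearMap.rTensor_mul]
  exact congrArg _ (reflPoly_comp_of_disjoint h)

theorem opR_mul_self (A : Finset (Fin n)) : opR V A * opR V A = 1 := by
  rw [opR, ← LinearMap.rTensor_mul]
  exact (congrArg _ (reflPoly_comp_self A)).trans (LinearMap.rTensor_id _ _)

theorem opZ_opX_self (i : Fin n) : opZ V i * opX V i = 0 := by
  rw [opZ, opX, ← LinearMap.rTensor_mul]
  exact (congrArg _ (restrictPoly_mulX_self i)).trans (LinearMap.rTensor_zero _)

theorem opZ_opX_of_ne {i j : Fin n} (h : j ≠ i) : Commute (opZ V i) (opX V j) := by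
  change _ = _
  rw [opZ, opX, ← LinearMap.rTensor_mul, ← LinearMap.rTensor_mul]
  exact congrArg _ (restrictPoly_mulX_of_ne h)

theorem opZ_opT_of_ne (μ : Fin n → ℝ) {i j : Fin n} (h : j ≠ i) :
    Commute (opZ V i) (opT V μ j) := by
  change _ = _
  rw [opZ, opT, ← LinearMap.rTensor_mul, ← LinearMap.rTensor_mul]
  exact congrArg _ (restrictPoly_dunklT_of_ne μ h)

theorem opT_opZ_self (μ : Fin n → ℝ) (i : Fin n) : opT V μ i * opZ V i = 0 := by
  rw [opZ, opT, ← LinearMap.rTensor_mul]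
  exact (congrArg _ (dunklT_restrictPoly μ i)).trans (LinearMap.rTensor_zero _)

theorem opZ_comm (i j : Fin n) : Commute (opZ V i) (opZ V j) := by
  change _ = _
  rw [opZ, opZ, ← LinearMap.rTensor_mul, ← LinearMap.rTensor_mul]
  exact congrArg _ (restrictPoly_comm i j)

theorem opZ_opR (i : Fin n) (A : Finset (Fin n)) : Commute (opZ V i) (opR V A) := by
  change _ = _
  rw [opZ, opR, ← LinearMap.rTensor_mul, ← LinearMap.rTensor_mul]
  exact congrArg _ (restrictPoly_reflPoly i A)

theorem opR_opZ_self (i : Fin n) : opR V {i} * opZ V i = opZ V i := by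
  rw [opR, opZ, ← LinearMap.rTensor_mul]
  exact congrArg _ (reflPoly_restrictPoly_self i)

theorem opZ_opR_self (i : Fin n) : opZ V i * opR V {i} = opZ V i := by
  rw [(opZ_opR V i {i}).eq, opR_opZ_self]

/-- A vector-valued polynomial is determined by its coordinates in the values. -/
theorem eq_zero_of_lTensor {y : VPoly n V}
    (h : ∀ f : V →ₗ[ℝ] ℝ, f.lTensor (MvPolynomial (Fin n) ℝ) y = 0) : y = 0 := by
  let b := Module.Free.chooseBasis ℝ V
  let E := TensorProduct.equivFinsuppOfBasisRight (M := MvPolynomial (Fin n) ℝ) b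
  apply E.injective
  rw [map_zero]
  ext1 k
  have h1 : ∀ z : VPoly n V, E z k
      = TensorProduct.rid ℝ _ ((b.coord k).lTensor (MvPolynomial (Fin n) ℝ) z) := by
    intro z
    induction z using TensorProduct.induction_on with
    | zero => simp
    | tmul p v => simp [E]
    | add p q hp hq => simp only [map_add, Finsupp.add_apply, hp, hq]
  rw [h1, h, map_zero, Finsupp.zero_apply]

variable {V} in
/-- A vector-valued polynomial is determined by the restrictions to `x_i = 0` of its iterated
images under the Dunkl operator `T_i`. -/
theorem eq_zero_of_opZ_opT_pow {μ : Fin n → ℝ} {i : Fin n} (hμ : 0 < μ i) {y : VPoly n V}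
    (h : ∀ b, opZ V i ((opT V μ i ^ b) y) = 0) : y = 0 := by
  refine eq_zero_of_lTensor V fun f => ?_
  apply (TensorProduct.rid ℝ (MvPolynomial (Fin n) ℝ)).injective
  rw [map_zero]
  refine eq_zero_of_restrictPoly_dunklT_pow hμ fun b => ?_
  have h1 : ∀ (g : Module.End ℝ (MvPolynomial (Fin n) ℝ)) (z : VPoly n V),
      g (TensorProduct.rid ℝ _ (f.lTensor (MvPolynomial (Fin n) ℝ) z))
        = TensorProduct.rid ℝ _ (f.lTensor (MvPolynomial (Fin n) ℝ) (g.rTensor V z)) := by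
    intro g z
    induction z using TensorProduct.induction_on with
    | zero => simp
    | tmul p v => simp
    | add p q hp hq => simp only [map_add, hp, hq]
  have h2 := h1 (restrictPoly i).toLinearMap
  simp only [AlgHom.toLinearMap_apply] at h2
  rw [h1, h2, ← LinearMap.rTensor_pow]
  exact (congrArg _ (congrArg _ (h b))).trans (by simp)

/-! ### The Clifford-valued coordinates and Dunkl operators -/

/-- The operator `e_i x_i`. -/
def opEX (i : Fin n) : Module.End ℝ (VPoly n V) := opE V i * opX V i

/-- The operator `e_i T_i`. -/
def opET (μ : Fin n → ℝ) (i : Fin n) : Module.End ℝ (VPoly n V) := opE V i * opT V μ i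

variable (μ : Fin n → ℝ)

theorem opEX_mul_opEX {i j : Fin n} (h : i ≠ j) : opEX V i * opEX V j = -(opEX V j * opEX V i) :=
  mul_mul_mul_of_commute (opE_mul_opE_of_ne V h) (opE_opX V _ _) (opE_opX V _ _) (opX_comm V _ _)

theorem opET_mul_opET {i j : Fin n} (h : i ≠ j) :
    opET V μ i * opET V μ j = -(opET V μ j * opET V μ i) :=
  mul_mul_mul_of_commute (opE_mul_opE_of_ne V h) (opE_opT V μ _ _) (opE_opT V μ _ _)
    (opT_comm V μ _ _)

theorem opET_mul_opEX {i j : Fin n} (h : i ≠ j) :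
    opET V μ i * opEX V j = -(opEX V j * opET V μ i) :=
  mul_mul_mul_of_commute (opE_mul_opE_of_ne V h) (opE_opT V μ _ _) (opE_opX V _ _)
    (opT_opX_of_ne V μ h)

theorem opEX_mul_opET {i j : Fin n} (h : i ≠ j) :
    opEX V i * opET V μ j = -(opET V μ j * opEX V i) := by
  rw [opET_mul_opEX V μ h.symm, neg_neg]

theorem opET_mul_opE {i j : Fin n} (h : i ≠ j) :
    opET V μ i * opE V j = -(opE V j * opET V μ i) := by
  rw [opET, mul_assoc, ← (opE_opT V μ j i).eq, ← mul_assoc, opE_mul_opE_of_ne V h, neg_mul,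
    mul_assoc]

theorem opEX_mul_opET_self (i : Fin n) : opEX V i * opET V μ i = -(opX V i * opT V μ i) := by
  calc opEX V i * opET V μ i = opE V i * (opX V i * opE V i) * opT V μ i := by
        simp only [opEX, opET, mul_assoc]
    _ = opE V i * opE V i * (opX V i * opT V μ i) := by
        rw [← (opE_opX V i i).eq]; simp only [mul_assoc]
    _ = _ := by rw [opE_mul_self]; simp

theorem opET_mul_opEX_eq (i : Fin n) : opET V μ i * opEX V i = -(opT V μ i * opX V i) := by
  calc opET V μ i * opEX V i = opE V i * (opT V μ i * opE V i) * opX V i := by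
        simp only [opEX, opET, mul_assoc]
    _ = opE V i * opE V i * (opT V μ i * opX V i) := by
        rw [← (opE_opT V μ i i).eq]; simp only [mul_assoc]
    _ = _ := by rw [opE_mul_self]; simp

theorem opET_mul_opEX_self (i : Fin n) :
    opET V μ i * opEX V i = opEX V i * opET V μ i - 1 - (2 * μ i) • opR V {i} := by
  rw [opET_mul_opEX_eq, opEX_mul_opET_self, opT_opX_self]; abel

theorem opR_opEX (A : Finset (Fin n)) (i : Fin n) :
    opR V A * opEX V i = (if i ∈ A then (-1 : ℝ) else 1) • (opEX V i * opR V A) := by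
  rw [opEX, ← mul_assoc, ← (opE_opR V i A).eq, mul_assoc, opR_opX, mul_smul_comm, mul_assoc]

theorem opR_opET (A : Finset (Fin n)) (i : Fin n) :
    opR V A * opET V μ i = (if i ∈ A then (-1 : ℝ) else 1) • (opET V μ i * opR V A) := by
  rw [opET, ← mul_assoc, ← (opE_opR V i A).eq, mul_assoc, opR_opT, mul_smul_comm, mul_assoc]

theorem opZ_opEX_self (i : Fin n) : opZ V i * opEX V i = 0 := by
  rw [opEX, (opE_opX V i i).eq, ← mul_assoc, opZ_opX_self, zero_mul]

theorem opET_opZ_self (i : Fin n) : opET V μ i * opZ V i = 0 := by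
  rw [opET, mul_assoc, opT_opZ_self, mul_zero]

theorem opZ_opEX_of_ne {i j : Fin n} (h : j ≠ i) : Commute (opZ V i) (opEX V j) :=
  (opE_opZ V j i).symm.mul_right (opZ_opX_of_ne V h)

theorem opZ_opET_of_ne {i j : Fin n} (h : j ≠ i) : Commute (opZ V i) (opET V μ j) :=
  (opE_opZ V j i).symm.mul_right (opZ_opT_of_ne V μ h)

end Operators

/-! ### The operators attached to sets of variables -/

theorem sum_mul_sum_of_anticommute {R ι : Type*} [Ring R] {A B : Finset ι} {f g : ι → R}
    (h : ∀ i ∈ A, ∀ j ∈ B, f i * g j = -(g j * f i)) :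
    (∑ i ∈ A, f i) * (∑ j ∈ B, g j) = -((∑ j ∈ B, g j) * ∑ i ∈ A, f i) := by
  rw [Finset.sum_mul_sum, Finset.sum_mul_sum, Finset.sum_comm, ← Finset.sum_neg_distrib]
  refine Finset.sum_congr rfl fun j hj => ?_
  rw [← Finset.sum_neg_distrib]
  exact Finset.sum_congr rfl fun i hi => h i hi j hj

section Operators

variable {n : ℕ} (V : Type*) [AddCommGroup V] [Module ℝ V] [Module (Cl n) V]
  [IsScalarTower ℝ (Cl n) V] (μ : Fin n → ℝ)

theorem position_singleton (i : Fin n) : position V {i} = opEX V i := Finset.sum_singleton _ _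

theorem dirac_singleton (i : Fin n) : dirac V μ {i} = opET V μ i := Finset.sum_singleton _ _

theorem position_empty : position V (∅ : Finset (Fin n)) = 0 := Finset.sum_empty

theorem dirac_empty : dirac V μ (∅ : Finset (Fin n)) = 0 := Finset.sum_empty

variable {A B : Finset (Fin n)}

theorem position_union (h : Disjoint A B) : position V (A ∪ B) = position V A + position V B :=
  Finset.sum_union h

theorem dirac_union (h : Disjoint A B) : dirac V μ (A ∪ B) = dirac V μ A + dirac V μ B :=
  Finset.sum_union h

theorem position_mul_position (h : Disjoint A B) :
    position V A * position V B = -(position V B * position V A) :=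
  sum_mul_sum_of_anticommute fun _ hi _ hj =>
    opEX_mul_opEX V (Finset.disjoint_iff_ne.mp h _ hi _ hj)

theorem dirac_mul_dirac (h : Disjoint A B) :
    dirac V μ A * dirac V μ B = -(dirac V μ B * dirac V μ A) :=
  sum_mul_sum_of_anticommute fun _ hi _ hj =>
    opET_mul_opET V μ (Finset.disjoint_iff_ne.mp h _ hi _ hj)

theorem position_mul_dirac (h : Disjoint A B) :
    position V A * dirac V μ B = -(dirac V μ B * position V A) :=
  sum_mul_sum_of_anticommute fun _ hi _ hj =>
    opEX_mul_opET V μ (Finset.disjoint_iff_ne.mp h _ hi _ hj)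

theorem dirac_mul_position (h : Disjoint A B) :
    dirac V μ A * position V B = -(position V B * dirac V μ A) := by
  rw [position_mul_dirac V μ h.symm, neg_neg]

theorem opR_mul_position_of_subset (h : B ⊆ A) :
    opR V A * position V B = -(position V B * opR V A) := by
  simp only [position, Finset.mul_sum, Finset.sum_mul, ← Finset.sum_neg_distrib]
  refine Finset.sum_congr rfl fun i hi => ?_
  have := opR_opEX V A i
  rw [if_pos (h hi), neg_one_smul] at this
  exact this

theorem opR_mul_dirac_of_subset (h : B ⊆ A) :
    opR V A * dirac V μ B = -(dirac V μ B * opR V A) := by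
  simp only [dirac, Finset.mul_sum, Finset.sum_mul, ← Finset.sum_neg_distrib]
  refine Finset.sum_congr rfl fun i hi => ?_
  have := opR_opET V μ A i
  rw [if_pos (h hi), neg_one_smul] at this
  exact this

theorem opR_commute_position (h : Disjoint A B) : Commute (opR V A) (position V B) := by
  refine Commute.sum_right _ _ _ fun i hi => ?_
  have := opR_opEX V A i
  rw [if_neg (Finset.disjoint_right.mp h hi), one_smul] at this
  exact this

theorem opR_commute_dirac (h : Disjoint A B) : Commute (opR V A) (dirac V μ B) := by
  refine Commute.sum_right _ _ _ fun i hi => ?_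
  have := opR_opET V μ A i
  rw [if_neg (Finset.disjoint_right.mp h hi), one_smul] at this
  exact this

theorem opZ_commute_position {i : Fin n} (h : i ∉ A) : Commute (opZ V i) (position V A) :=
  Commute.sum_right _ _ _ fun _ hj => opZ_opEX_of_ne V (ne_of_mem_of_not_mem hj h)

theorem opZ_commute_dirac {i : Fin n} (h : i ∉ A) : Commute (opZ V i) (dirac V μ A) :=
  Commute.sum_right _ _ _ fun _ hj => opZ_opET_of_ne V μ (ne_of_mem_of_not_mem hj h)

/-! ### The `osp(1|2)` relations -/

/-- In one variable the reflection terms cancel because `r_i` anticommutes with `e_i x_i`. Distinct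
variables contribute only anticommuting cross terms, so the relation survives the addition of
variables. -/
theorem position_sq_mul_dirac (A : Finset (Fin n)) :
    position V A * position V A * dirac V μ A
      = dirac V μ A * (position V A * position V A) + 2 * position V A := by
  induction A using Finset.induction_on with
  | empty => simp [position_empty]
  | insert i A hi ih =>
    have hd : Disjoint {i} A := Finset.disjoint_singleton_left.mpr hi
    rw [Finset.insert_eq, position_union V hd, dirac_union V μ hd]
    have h1 := position_mul_position V hd
    have h2 := position_mul_dirac V μ hd
    have h3 := dirac_mul_position V μ hd
    have h4 : opEX V i * opEX V i * opET V μ i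
        = opET V μ i * (opEX V i * opEX V i) + 2 * opEX V i := by
      have h5 := opET_mul_opEX_self V μ i
      have h6 := opR_opEX V {i} i
      rw [if_pos (Finset.mem_singleton_self i), neg_one_smul] at h6
      have h7 : (2 * μ i) • opR V {i} * opEX V i = -(opEX V i * ((2 * μ i) • opR V {i})) := by
        rw [smul_mul_assoc, h6, mul_smul_comm, smul_neg]
      generalize (2 * μ i) • opR V {i} = r at *
      linear_combination (norm := noncomm_ring) (-1 : ℤ) • (h5 * opEX V i) - opEX V i * h5 + h7
    rw [position_singleton, dirac_singleton] at *
    generalize opEX V i = x at *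
    generalize opET V μ i = d at *
    generalize position V A = X at *
    generalize dirac V μ A = D at *
    linear_combination (norm := noncomm_ring) h4 + ih + h1 * (d + D) - (d + D) * h1
      + x * h2 - h2 * x + X * h3 - h3 * X

theorem position_mul_dirac_sq (A : Finset (Fin n)) :
    position V A * (dirac V μ A * dirac V μ A)
      = dirac V μ A * dirac V μ A * position V A + 2 * dirac V μ A := by
  induction A using Finset.induction_on with
  | empty => simp [dirac_empty]
  | insert i A hi ih =>
    have hd : Disjoint {i} A := Finset.disjoint_singleton_left.mpr hi
    rw [Finset.insert_eq, position_union V hd, dirac_union V μ hd]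
    have h1 := dirac_mul_dirac V μ hd
    have h2 := position_mul_dirac V μ hd
    have h3 := dirac_mul_position V μ hd
    have h4 : opEX V i * (opET V μ i * opET V μ i)
        = opET V μ i * opET V μ i * opEX V i + 2 * opET V μ i := by
      have h5 := opET_mul_opEX_self V μ i
      have h6 := opR_opET V μ {i} i
      rw [if_pos (Finset.mem_singleton_self i), neg_one_smul] at h6
      have h7 : (2 * μ i) • opR V {i} * opET V μ i = -(opET V μ i * ((2 * μ i) • opR V {i})) := by
        rw [smul_mul_assoc, h6, mul_smul_comm, smul_neg]
      generalize (2 * μ i) • opR V {i} = r at *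
      linear_combination (norm := noncomm_ring) (-1 : ℤ) • (h5 * opET V μ i) - opET V μ i * h5 + h7
    rw [position_singleton, dirac_singleton] at *
    generalize opEX V i = x at *
    generalize opET V μ i = d at *
    generalize position V A = X at *
    generalize dirac V μ A = D at *
    linear_combination (norm := noncomm_ring) h4 + ih + x * h1 - h1 * x + X * h1 - h1 * X
      + h2 * D - D * h2 + h3 * d - d * h3

variable (A) in
/-- The operator `-(x_A D_A + D_A x_A) / 2`, which acts on polynomials of degree `d` in the
variables `x_i`, `i ∈ A`, as the scalar `d + ∑_{i ∈ A} (μ_i + 1/2)`. -/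
def weightOp : Module.End ℝ (VPoly n V) :=
  (-(1 / 2) : ℝ) • (position V A * dirac V μ A + dirac V μ A * position V A)

/-- In the anticommutator the terms `x D x` cancel, and half of `[x_A², D_A] - 2 x_A = 0` is left.
-/
theorem sCasimir_mul_position (A : Finset (Fin n)) :
    sCasimir V μ A * position V A = -(position V A * sCasimir V μ A) := by
  have h := position_sq_mul_dirac V μ A
  rw [sCasimir, smul_mul_assoc, mul_smul_comm, ← smul_neg]
  congr 1
  linear_combination (norm := noncomm_ring) h

theorem sCasimir_mul_dirac (A : Finset (Fin n)) :
    sCasimir V μ A * dirac V μ A = -(dirac V μ A * sCasimir V μ A) := by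
  have h := position_mul_dirac_sq V μ A
  rw [sCasimir, smul_mul_assoc, mul_smul_comm, ← smul_neg]
  congr 1
  linear_combination (norm := noncomm_ring) h

theorem weightOp_mul_position (A : Finset (Fin n)) :
    weightOp V μ A * position V A = position V A * weightOp V μ A + position V A := by
  have h := position_sq_mul_dirac V μ A
  -- Splitting `1` as `(-1/2)(-2)` lets the real factor `-1/2` be cancelled throughout, leaving an
  -- identity with integer coefficients.
  have h2 : position V A = (-(1 / 2) : ℝ) • ((-2 : ℤ) • position V A) := by
    rw [← Int.cast_smul_eq_zsmul ℝ, smul_smul]; norm_num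
  conv_rhs => rw [h2]
  conv_rhs => enter [1]; rw [← h2]
  rw [weightOp, smul_mul_assoc, mul_smul_comm, ← smul_add]
  congr 1
  linear_combination (norm := noncomm_ring) (-1 : ℤ) • h

theorem weightOp_mul_dirac (A : Finset (Fin n)) :
    weightOp V μ A * dirac V μ A = dirac V μ A * weightOp V μ A - dirac V μ A := by
  have h := position_mul_dirac_sq V μ A
  have h2 : dirac V μ A = (-(1 / 2) : ℝ) • ((-2 : ℤ) • dirac V μ A) := by
    rw [← Int.cast_smul_eq_zsmul ℝ, smul_smul]; norm_num
  conv_rhs => rw [h2]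
  conv_rhs => enter [1]; rw [← h2]
  rw [weightOp, smul_mul_assoc, mul_smul_comm, ← smul_sub]
  congr 1
  linear_combination (norm := noncomm_ring) h

/-- Both orders of the product are expressed through `sCasimir` and `weightOp`, which act as scalars
on a power of `x_A` applied to a homogeneous monogenic. -/
theorem position_mul_dirac_self (A : Finset (Fin n)) :
    position V A * dirac V μ A = sCasimir V μ A - weightOp V μ A + (1 / 2 : ℝ) • 1 := by
  rw [sCasimir, weightOp]; module

theorem dirac_mul_position_self (A : Finset (Fin n)) :
    dirac V μ A * position V A = -(sCasimir V μ A + weightOp V μ A + (1 / 2 : ℝ) • 1) := by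
  rw [sCasimir, weightOp]; module

/-! ### Splitting the operators over disjoint blocks. -/

/-- Cross terms anticommute, so the commutator doubles them; the `1/2` compensates for the constant
`-1/2` that both blocks contain. -/
theorem sCasimir_union (h : Disjoint A B) :
    sCasimir V μ (A ∪ B) = sCasimir V μ A + sCasimir V μ B + (1 / 2 : ℝ) • 1
      + (position V A * dirac V μ B + position V B * dirac V μ A) := by
  have h1 := dirac_mul_position V μ h
  have h2 := dirac_mul_position V μ h.symm
  simp only [sCasimir, position_union V h, dirac_union V μ h, add_mul, mul_add, h1, h2]
  module

theorem weightOp_union (h : Disjoint A B) :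
    weightOp V μ (A ∪ B) = weightOp V μ A + weightOp V μ B := by
  have h1 := dirac_mul_position V μ h
  have h2 := dirac_mul_position V μ h.symm
  simp only [weightOp, position_union V h, dirac_union V μ h, add_mul, mul_add, h1, h2]
  module

theorem sCasimir_singleton (i : Fin n) : sCasimir V μ {i} = μ i • opR V {i} := by
  rw [sCasimir, position_singleton, dirac_singleton, opET_mul_opEX_self]
  module

theorem Gam_singleton (i : Fin n) : Gam V μ {i} = μ i • 1 := by
  rw [Gam, sCasimir_singleton, smul_mul_assoc, opR_mul_self]

/-! ### Operators that commute with `sCasimir` and `Γ`. -/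

theorem sCasimir_commute_position (h : Disjoint A B) :
    Commute (sCasimir V μ A) (position V B) := by
  have h1 := dirac_mul_position V μ h
  have h2 := position_mul_position V h
  refine Commute.smul_left (?_ : _ = _) _
  linear_combination (norm := noncomm_ring) position V A * h1 - h2 * dirac V μ A
    - dirac V μ A * h2 + h1 * position V A

theorem sCasimir_commute_dirac (h : Disjoint A B) :
    Commute (sCasimir V μ A) (dirac V μ B) := by
  have h1 := dirac_mul_dirac V μ h
  have h2 := position_mul_dirac V μ h
  refine Commute.smul_left (?_ : _ = _) _
  linear_combination (norm := noncomm_ring) position V A * h1 - h2 * dirac V μ A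
    - dirac V μ A * h2 + h1 * position V A

theorem Gam_commute_position_self (A : Finset (Fin n)) : Commute (Gam V μ A) (position V A) := by
  have h1 := sCasimir_mul_position V μ A
  have h2 := opR_mul_position_of_subset V (Finset.Subset.refl A)
  change _ = _
  rw [Gam]
  linear_combination (norm := noncomm_ring) sCasimir V μ A * h2 - h1 * opR V A

theorem Gam_commute_dirac_self (A : Finset (Fin n)) : Commute (Gam V μ A) (dirac V μ A) := by
  have h1 := sCasimir_mul_dirac V μ A
  have h2 := opR_mul_dirac_of_subset V μ (Finset.Subset.refl A)
  change _ = _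
  rw [Gam]
  linear_combination (norm := noncomm_ring) sCasimir V μ A * h2 - h1 * opR V A

/-- On the block `A` both factors of `Γ_A` anticommute with `x_A`. On the complement both commute,
since `sCasimir` is even in the anticommuting generators and the reflections leave the other
variables alone. -/
theorem Gam_commute_position (h : A ⊆ B) : Commute (Gam V μ A) (position V B) := by
  rw [← Finset.union_sdiff_of_subset h, position_union V Finset.disjoint_sdiff]
  exact (Gam_commute_position_self V μ A).add_right
    ((sCasimir_commute_position V μ Finset.disjoint_sdiff).mul_left
      (opR_commute_position V Finset.disjoint_sdiff))

theorem Gam_commute_dirac (h : A ⊆ B) : Commute (Gam V μ A) (dirac V μ B) := by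
  rw [← Finset.union_sdiff_of_subset h, dirac_union V μ Finset.disjoint_sdiff]
  exact (Gam_commute_dirac_self V μ A).add_right
    ((sCasimir_commute_dirac V μ Finset.disjoint_sdiff).mul_left
      (opR_commute_dirac V μ Finset.disjoint_sdiff))

theorem opZ_commute_sCasimir {i : Fin n} (h : i ∉ A) : Commute (opZ V i) (sCasimir V μ A) := by
  have hx := opZ_commute_position V h
  have hd := opZ_commute_dirac V μ h
  exact (((hx.mul_right hd).sub_right (hd.mul_right hx)).sub_right
    (Commute.one_right _)).smul_right _

theorem opZ_commute_Gam {i : Fin n} (h : i ∉ A) : Commute (opZ V i) (Gam V μ A) :=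
  (opZ_commute_sCasimir V μ h).mul_right (opZ_opR V i A)

theorem opZ_commute_weightOp {i : Fin n} (h : i ∉ A) : Commute (opZ V i) (weightOp V μ A) := by
  have hx := opZ_commute_position V h
  have hd := opZ_commute_dirac V μ h
  exact ((hx.mul_right hd).add_right (hd.mul_right hx)).smul_right _

theorem opZ_mul_weightOp_singleton (i : Fin n) :
    opZ V i * weightOp V μ {i} = (μ i + 1 / 2) • opZ V i := by
  rw [weightOp, position_singleton, dirac_singleton, opET_mul_opEX_self, mul_smul_comm]
  simp only [mul_add, mul_sub, ← mul_assoc, opZ_opEX_self, mul_smul_comm, opZ_opR_self, mul_one,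
    zero_mul]
  module

/-- The square of `x_A` is multiplication by the nonzero polynomial `-∑ x_i²`, and tensoring with
`V` over a field preserves injectivity. -/
theorem position_injective (h : A.Nonempty) : Function.Injective (position V A) := by
  have h1 : position V A * position V A
      = (LinearMap.mulLeft ℝ (-∑ i ∈ A, X i * X i : MvPolynomial (Fin n) ℝ)).rTensor V := by
    have h2 : ∀ p : MvPolynomial (Fin n) ℝ, (LinearMap.mulLeft ℝ p).rTensor V
        = LinearMap.rTensorHom V (LinearMap.mulLeft ℝ p) := fun _ => rfl
    clear h
    induction A using Finset.induction_on with
    | empty => rw [position_empty, Finset.sum_empty, neg_zero, h2, LinearMap.mulLeft_zero_eq_zero,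
        map_zero, mul_zero]
    | insert i A hi ih =>
      have hd : Disjoint {i} A := Finset.disjoint_singleton_left.mpr hi
      have h3 := position_mul_position V hd
      have h4 : opEX V i * opEX V i
          = (LinearMap.mulLeft ℝ (-(X i * X i) : MvPolynomial (Fin n) ℝ)).rTensor V := by
        have h5 : opEX V i * opEX V i = -(opX V i * opX V i) := by
          rw [opEX, mul_assoc, ← mul_assoc (opX V i), ← (opE_opX V i i).eq, mul_assoc, ← mul_assoc,
            opE_mul_self]; simp
        rw [h5, opX, ← LinearMap.rTensor_mul, ← LinearMap.rTensor_neg]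
        congr 1
        apply LinearMap.ext; intro p
        simp [mul_assoc]
      have h6 : LinearMap.mulLeft ℝ (-∑ j ∈ insert i A, X j * X j : MvPolynomial (Fin n) ℝ)
          = LinearMap.mulLeft ℝ (-(X i * X i)) + LinearMap.mulLeft ℝ (-∑ j ∈ A, X j * X j) := by
        rw [Finset.sum_insert hi]
        apply LinearMap.ext; intro p
        simp only [LinearMap.mulLeft_apply, LinearMap.add_apply]
        ring
      rw [h6, LinearMap.rTensor_add, ← ih, ← h4, Finset.insert_eq, position_union V hd,
        ← position_singleton]
      linear_combination (norm := noncomm_ring) h3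
  have h2 : (-∑ i ∈ A, X i * X i : MvPolynomial (Fin n) ℝ) ≠ 0 := by
    intro h0
    have := congrArg (eval fun _ => (1 : ℝ)) h0
    simp at this
    exact h.ne_empty this
  have h3 : Function.Injective (position V A * position V A) := by
    rw [h1]
    exact Module.Flat.rTensor_preserves_injective_linearMap _ (mul_right_injective₀ h2)
  exact Function.Injective.of_comp h3

variable {V}

theorem opET_eq_zero {i : Fin n} {y : VPoly n V} (h : opZ V i y = y) : opET V μ i y = 0 := by
  rw [← h, ← Module.End.mul_apply, opET_opZ_self, LinearMap.zero_apply]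

theorem opT_eq_zero {i : Fin n} {y : VPoly n V} (h : opZ V i y = y) : opT V μ i y = 0 := by
  rw [← h, ← Module.End.mul_apply, opT_opZ_self, LinearMap.zero_apply]

theorem opR_eq_self {i : Fin n} {y : VPoly n V} (h : opZ V i y = y) : opR V {i} y = y := by
  rw [← h, ← Module.End.mul_apply, opR_opZ_self]

end Operators

/-! ### Uniqueness of monogenic extensions -/

section Operators

variable {n : ℕ} {V : Type*} [AddCommGroup V] [Module ℝ V] [Module (Cl n) V]
  [IsScalarTower ℝ (Cl n) V] (μ : Fin n → ℝ) {A B : Finset (Fin n)} {i : Fin n}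

theorem opE_eq_zero {y : VPoly n V} (h : opE V i y = 0) : y = 0 := by
  have h1 := congrArg (opE V i) h
  rw [← Module.End.mul_apply, opE_mul_self, map_zero] at h1
  simpa using h1

theorem opT_commute_dirac (A : Finset (Fin n)) : Commute (opT V μ i) (dirac V μ A) :=
  Commute.sum_right _ _ _ fun j _ => (opE_opT V μ j i).symm.mul_right (opT_comm V μ i j)

theorem opT_commute_position (h : i ∉ A) : Commute (opT V μ i) (position V A) :=
  Commute.sum_right _ _ _ fun j hj => (opE_opT V μ j i).symm.mul_right
    (opT_opX_of_ne V μ (ne_of_mem_of_not_mem hj h).symm)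

theorem opX_commute_dirac (h : i ∉ A) : Commute (opX V i) (dirac V μ A) :=
  Commute.sum_right _ _ _ fun j hj => (opE_opX V j i).symm.mul_right
    (opT_opX_of_ne V μ (ne_of_mem_of_not_mem hj h)).symm

theorem opT_commute_sCasimir (h : i ∉ A) : Commute (opT V μ i) (sCasimir V μ A) := by
  have hx := opT_commute_position (V := V) μ h
  have hd := opT_commute_dirac (V := V) (i := i) μ A
  exact (((hx.mul_right hd).sub_right (hd.mul_right hx)).sub_right
    (Commute.one_right _)).smul_right _

theorem dirac_mul_opE (h : i ∉ A) : dirac V μ A * opE V i = -(opE V i * dirac V μ A) := by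
  simp only [dirac, Finset.mul_sum, Finset.sum_mul, ← Finset.sum_neg_distrib]
  exact Finset.sum_congr rfl fun j hj => opET_mul_opE V μ (ne_of_mem_of_not_mem hj h)

theorem dirac_insert (h : i ∉ A) : dirac V μ (insert i A) = opET V μ i + dirac V μ A :=
  Finset.sum_insert h

theorem position_insert (h : i ∉ A) : position V (insert i A) = opEX V i + position V A :=
  Finset.sum_insert h

/-- A polynomial in the kernel of `D_{A ∪ {i}}` is determined by its restriction to `x_i = 0`. -/
theorem eq_zero_of_dirac_insert (hμ : 0 < μ i) (hi : i ∉ A) {F : VPoly n V}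
    (hD : dirac V μ (insert i A) F = 0) (hZ : opZ V i F = 0) : F = 0 := by
  refine eq_zero_of_opZ_opT_pow hμ fun b => ?_
  induction b with
  | zero => simpa using hZ
  | succ b ih =>
    apply opE_eq_zero (i := i)
    -- Monogenicity trades one `T_i` for `-D_A`, up to `e_i`; as `D_A` commutes with the restriction
    -- and with `T_i`, each restricted derivative vanishes with the previous one.
    have h1 : opET V μ i F = -dirac V μ A F := by
      rw [dirac_insert μ hi, LinearMap.add_apply] at hD
      exact eq_neg_of_add_eq_zero_left hD
    have h2 : (opE V i * (opZ V i * opT V μ i ^ (b + 1))) = opZ V i * opT V μ i ^ b * opET V μ i := by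
      rw [pow_succ, opET]
      calc _ = opE V i * (opZ V i * opT V μ i ^ b) * opT V μ i := by noncomm_ring
        _ = _ := by rw [((opE_opZ V i i).mul_right ((opE_opT V μ i i).pow_right b)).eq]; noncomm_ring
    have h3 : opZ V i * opT V μ i ^ b * dirac V μ A = dirac V μ A * (opZ V i * opT V μ i ^ b) :=
      ((opZ_commute_dirac V μ hi).mul_left ((opT_commute_dirac μ A).pow_left b)).eq
    change (opE V i * (opZ V i * opT V μ i ^ (b + 1))) F = 0
    rw [h2, Module.End.mul_apply, h1, map_neg, ← Module.End.mul_apply, h3]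
    simp only [Module.End.mul_apply, ih, map_zero, neg_zero]

theorem eq_of_dirac_insert (hμ : 0 < μ i) (hi : i ∉ A) {F G : VPoly n V}
    (hF : dirac V μ (insert i A) F = 0) (hG : dirac V μ (insert i A) G = 0)
    (hZ : opZ V i F = opZ V i G) : F = G := by
  rw [← sub_eq_zero]
  refine eq_zero_of_dirac_insert μ hμ hi ?_ ?_ <;> rw [map_sub]
  · rw [hF, hG, sub_zero]
  · rw [hZ, sub_self]

theorem opT_pow_mul_opR (A : Finset (Fin n)) (b : ℕ) :
    opT V μ i ^ b * opR V A
      = ((if i ∈ A then (-1 : ℝ) else 1) ^ b) • (opR V A * opT V μ i ^ b) := by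
  have h1 : opT V μ i * opR V A = (if i ∈ A then (-1 : ℝ) else 1) • (opR V A * opT V μ i) := by
    rw [opR_opT, smul_smul]; split_ifs <;> simp
  induction b with
  | zero => simp
  | succ b ih =>
    rw [pow_succ', mul_assoc, ih, mul_smul_comm, ← mul_assoc, h1, smul_mul_assoc, smul_smul,
      ← pow_succ, mul_assoc]

theorem opZ_opT_pow_opX (b : ℕ) :
    opZ V i * opT V μ i ^ (b + 1) * opX V i
      = dunklNat (μ i) (b + 1) • (opZ V i * opT V μ i ^ b) := by
  have hR : ∀ b, opZ V i * (opT V μ i ^ b * opR V {i})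
      = ((-1 : ℝ) ^ b) • (opZ V i * opT V μ i ^ b) := by
    intro b
    rw [opT_pow_mul_opR, if_pos (Finset.mem_singleton_self i), mul_smul_comm, ← mul_assoc,
      opZ_opR_self]
  have h1 : ∀ b, opZ V i * opT V μ i ^ (b + 1) * opX V i
      = opZ V i * opT V μ i ^ b * opX V i * opT V μ i + (1 + 2 * μ i * (-1) ^ b) •
        (opZ V i * opT V μ i ^ b) := by
    intro b
    rw [pow_succ, mul_assoc, mul_assoc _ _ (opX V i), opT_opX_self]
    simp only [mul_add, mul_one, mul_smul_comm, hR, add_smul, one_smul, smul_smul, add_assoc,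
      mul_assoc]
  induction b with
  | zero =>
    rw [h1, pow_zero, mul_one, opZ_opX_self, zero_mul, zero_add, dunklNat_succ, dunklNat_zero]
    simp
  | succ b ih =>
    rw [h1, ih, dunklNat_succ _ (b + 1), smul_mul_assoc, mul_assoc, ← pow_succ, ← add_smul]
    congr 1; ring

/-- An eigenvector of `Γ_{B ∪ {i}}` is determined by its restriction to `x_i = 0`. -/
theorem eq_zero_of_Gam_insert (hμ : 0 < μ i) (hi : i ∉ B) (hB : B.Nonempty) {u : VPoly n V}
    {c : ℝ} (hG : Gam V μ (insert i B) u = c • u) (hZ : opZ V i u = 0) : u = 0 := by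
  -- Passing to `y` turns the eigenvalue equation into `S y = c r y`, where the reflection only
  -- changes signs of restricted derivatives.
  set y := opR V (insert i B) u with hy
  have hRy : opR V (insert i B) y = u := by
    rw [hy, ← Module.End.mul_apply, opR_mul_self, Module.End.one_apply]
  have hS : sCasimir V μ (insert i B) y = c • opR V (insert i B) y := by rw [hRy]; exact hG
  suffices h : y = 0 by rw [← hRy, h, map_zero]
  have key : ∀ b, ∀ a ≤ b, opZ V i ((opT V μ i ^ a) y) = 0 := by
    intro b
    induction b with
    | zero =>
      intro a ha
      obtain rfl : a = 0 := by omega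
      rw [pow_zero, Module.End.one_apply, hy, ← Module.End.mul_apply, (opZ_opR V i _).eq,
        Module.End.mul_apply, hZ, map_zero]
    | succ b ih =>
      intro a ha
      rcases Nat.lt_or_ge a (b + 1) with h | h
      · exact ih a (by omega)
      obtain rfl : a = b + 1 := by omega
      have hb : (opZ V i * opT V μ i ^ b) y = 0 := ih b le_rfl
      have hR : ∀ A : Finset (Fin n), (opZ V i * opT V μ i ^ b) (opR V A y) = 0 := by
        intro A
        rw [← Module.End.mul_apply, mul_assoc, opT_pow_mul_opR, mul_smul_comm, ← mul_assoc,
          (opZ_opR V i A).eq, mul_assoc, LinearMap.smul_apply, Module.End.mul_apply, hb, map_zero,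
          smul_zero]
      have h1 : (opZ V i * opT V μ i ^ b) (sCasimir V μ B y) = 0 := by
        rw [← Module.End.mul_apply, ((opZ_commute_sCasimir V μ hi).mul_left
          ((opT_commute_sCasimir μ hi).pow_left b)).eq, Module.End.mul_apply, hb, map_zero]
      have h2 : (opZ V i * opT V μ i ^ b) (opEX V i (dirac V μ B y)) = 0 := by
        have hx : opZ V i * opT V μ i ^ b * opEX V i
            = opE V i * (opZ V i * opT V μ i ^ b * opX V i) := by
          rw [opEX, ← mul_assoc,
            ← ((opE_opZ V i i).mul_right ((opE_opT V μ i i).pow_right b)).eq]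
          noncomm_ring
        rw [← Module.End.mul_apply, hx]
        rcases b with _ | b
        · simp [opZ_opX_self]
        · rw [opZ_opT_pow_opX, ← Module.End.mul_apply, mul_smul_comm, smul_mul_assoc, mul_assoc,
            ((opZ_commute_dirac V μ hi).mul_left ((opT_commute_dirac μ B).pow_left b)).eq]
          have := ih b (by omega)
          simp only [LinearMap.smul_apply, Module.End.mul_apply, this, map_zero, smul_zero]
      have h3 : (opZ V i * opT V μ i ^ b) (position V B (opET V μ i y))
          = position V B (opE V i (opZ V i ((opT V μ i ^ (b + 1)) y))) := by
        simp only [← Module.End.mul_apply]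
        congr 1
        rw [← mul_assoc, ((opZ_commute_position V hi).mul_left
          ((opT_commute_position μ hi).pow_left b)).eq, opET, mul_assoc, mul_assoc, ← mul_assoc _ (opE V i),
          ← ((opE_opT V μ i i).pow_right b).eq, pow_succ, mul_assoc (opE V i), ← mul_assoc (opZ V i),
          ← (opE_opZ V i i).eq, mul_assoc]
      -- Expanded over `{i} ∪ B`, only the term `x_B e_i T_i` involves the restricted derivative of
      -- order `b + 1`; all others vanish by induction. Injectivity of `x_B`, hence `B` nonempty,
      -- then gives the next order.
      have h4 := congrArg (opZ V i * opT V μ i ^ b) hS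
      rw [Finset.insert_eq, sCasimir_union V μ (Finset.disjoint_singleton_left.mpr hi),
        sCasimir_singleton, position_singleton, dirac_singleton] at h4
      simp only [LinearMap.add_apply, LinearMap.smul_apply, map_add, map_smul, hR, h1,
        Module.End.mul_apply (opEX V i), Module.End.mul_apply (position V B), h2, h3,
        Module.End.one_apply, hb, smul_zero, zero_add] at h4
      exact opE_eq_zero ((map_eq_zero_iff _ (position_injective V hB)).mp h4)
  exact eq_zero_of_opZ_opT_pow hμ fun b => key b b le_rfl

/-! ### The Cauchy-Kovalevskaia extension -/

theorem opR_opX_pow {y : VPoly n V} (hy : opZ V i y = y) (l : ℕ) :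
    opR V {i} ((opX V i ^ l) y) = ((-1 : ℝ) ^ l) • (opX V i ^ l) y := by
  induction l with
  | zero => simpa using opR_eq_self hy
  | succ l ih =>
    have h := opR_opX V {i} i
    rw [if_pos (Finset.mem_singleton_self i)] at h
    rw [pow_succ' (opX V i), Module.End.mul_apply, ← Module.End.mul_apply, h, LinearMap.smul_apply,
      Module.End.mul_apply, ih, map_smul, smul_smul, pow_succ']

theorem opT_opX_pow {y : VPoly n V} (hy : opZ V i y = y) (l : ℕ) :
    opT V μ i ((opX V i ^ (l + 1)) y) = dunklNat (μ i) (l + 1) • (opX V i ^ l) y := by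
  have h1 : ∀ l, opT V μ i ((opX V i ^ (l + 1)) y)
      = opX V i (opT V μ i ((opX V i ^ l) y)) + (1 + 2 * μ i * (-1) ^ l) • (opX V i ^ l) y := by
    intro l
    rw [pow_succ', Module.End.mul_apply, ← Module.End.mul_apply, opT_opX_self]
    simp only [LinearMap.add_apply, LinearMap.smul_apply, Module.End.one_apply,
      Module.End.mul_apply, opR_opX_pow hy]
    module
  induction l with
  | zero =>
    rw [h1, pow_zero, Module.End.one_apply, opT_eq_zero μ hy, dunklNat_succ, dunklNat_zero]
    simp
  | succ l ih =>
    rw [h1, ih, map_smul, ← Module.End.mul_apply, ← pow_succ', ← add_smul, dunklNat_succ _ (l + 1)]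
    congr 1; ring

theorem Iic_eq_insert_Iio (i : Fin n) : Finset.Iic i = insert i (Finset.Iio i) :=
  (Finset.Iio_insert i).symm

theorem opZ_CK (hμ : 0 < μ i) (k : ℕ) {p : VPoly n V} (hp : opZ V i p = p) :
    opZ V i (CK V μ i k p) = p := by
  have h1 : ∀ l, opZ V i ((opX V i ^ (l + 1)) ((dirac V μ (Finset.Iio i) ^ (l + 1)) p)) = 0 := by
    intro l
    rw [pow_succ', Module.End.mul_apply, ← Module.End.mul_apply, opZ_opX_self, LinearMap.zero_apply]
  have h2 : opZ V i * (opE V i * opX V i * dirac V μ (Finset.Iio i)) = 0 := by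
    change opZ V i * (opEX V i * _) = 0
    rw [← mul_assoc, opZ_opEX_self, zero_mul]
  have h3 : Real.Gamma (μ i + 1 / 2) ≠ 0 := (Real.Gamma_pos_of_pos (by linarith)).ne'
  rw [CK]
  simp only [LinearMap.add_apply, LinearMap.smul_apply, map_add, map_smul, LinearMap.sum_apply,
    map_sum]
  rw [← Module.End.mul_apply (opZ V i), ← mul_assoc, h2, zero_mul, LinearMap.zero_apply, smul_zero,
    add_zero, Finset.sum_range_succ', Finset.sum_eq_zero]
  · simp only [mul_zero, pow_zero, Nat.factorial_zero, Nat.cast_zero, Nat.cast_one, mul_one,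
      one_mul, zero_add, div_self h3, one_smul, Module.End.one_apply, hp]
  · intro l _
    rw [show 2 * (l + 1) = 2 * l + 1 + 1 by ring, Module.End.mul_apply, h1, smul_zero]

theorem dirac_CK (hμ : 0 < μ i) (k : ℕ) {p : VPoly n V} (hp : opZ V i p = p)
    (hk : (dirac V μ (Finset.Iio i) ^ (k + 1)) p = 0) :
    dirac V μ (Finset.Iic i) (CK V μ i k p) = 0 := by
  have hi : i ∉ Finset.Iio i := by simp
  set D := dirac V μ (Finset.Iio i) with hDdef
  set α : ℕ → ℝ := fun l =>
    Real.Gamma (μ i + 1 / 2) / (2 ^ (2 * l) * l.factorial * Real.Gamma (l + μ i + 1 / 2)) with hα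
  set β : ℕ → ℝ := fun l =>
    Real.Gamma (μ i + 1 / 2) / (2 ^ (2 * l) * l.factorial * Real.Gamma (l + μ i + 3 / 2)) with hβ
  have hG : ∀ l : ℕ, Real.Gamma (l + μ i + 3 / 2)
      = (l + μ i + 1 / 2) * Real.Gamma (l + μ i + 1 / 2) := by
    intro l
    have h0 : (l : ℝ) + μ i + 1 / 2 ≠ 0 := by positivity
    rw [← Real.Gamma_add_one h0]; congr 1; ring
  -- This recursion and the next make the contributions of `e_i T_i` and `D` cancel power by power
  -- in `x_i`; the Dunkl integers come from applying `T_i` to powers of `x_i`.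
  have hαβ : ∀ l, α l = 1 / 2 * (β l * dunklNat (μ i) (2 * l + 1)) := by
    intro l
    have h0 : (l : ℝ) + μ i + 1 / 2 ≠ 0 := by positivity
    have h1 : Real.Gamma (l + μ i + 1 / 2) ≠ 0 := (Real.Gamma_pos_of_pos (by positivity)).ne'
    have h2 : dunklNat (μ i) (2 * l + 1) = 2 * (l + μ i + 1 / 2) := by
      simp [dunklNat, pow_succ, pow_mul]; ring
    simp only [hα, hβ]
    rw [h2, hG]
    field_simp
  have hβα : ∀ l, α (l + 1) * dunklNat (μ i) (2 * l + 1 + 1) = 1 / 2 * β l := by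
    intro l
    have h1 : Real.Gamma (l + μ i + 3 / 2) ≠ 0 := (Real.Gamma_pos_of_pos (by positivity)).ne'
    have h2 : dunklNat (μ i) (2 * l + 1 + 1) = 2 * (l + 1) := by
      simp [dunklNat, pow_succ, pow_mul]; ring
    simp only [hα, hβ]
    rw [h2, show ((l + 1 : ℕ) : ℝ) + μ i + 1 / 2 = l + μ i + 3 / 2 by push_cast; ring,
      Nat.factorial_succ]
    push_cast
    field_simp
    ring
  set y : ℕ → VPoly n V := fun l => (D ^ l) p with hy
  have hDy : ∀ l, D (y l) = y (l + 1) := by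
    intro l; simp only [hy, pow_succ', Module.End.mul_apply]
  have hZy : ∀ l, opZ V i (y l) = y l := by
    intro l
    simp only [hy]
    rw [← Module.End.mul_apply, ((opZ_commute_dirac V μ hi).pow_right l).eq, Module.End.mul_apply, hp]
  have hy0 : ∀ l, k + 1 ≤ l → y l = 0 := by
    intro l hl
    obtain ⟨t, rfl⟩ := Nat.exists_eq_add_of_le hl
    simp only [hy]
    rw [add_comm, pow_add, Module.End.mul_apply, hk, map_zero]
  have hXD : ∀ l (z : VPoly n V), D ((opX V i ^ l) z) = (opX V i ^ l) (D z) := by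
    intro l z
    rw [← Module.End.mul_apply, ← ((opX_commute_dirac μ hi).pow_left l).eq, Module.End.mul_apply]
  -- Both sums can be extended to the common range up to `k`, since the added terms contain a power
  -- of `D` of order at least `k + 1`.
  have hCK : CK V μ i k p = ∑ l ∈ Finset.range (k + 1), α l • (opX V i ^ (2 * l)) (y (2 * l))
      + (1 / 2 : ℝ) • opE V i (∑ l ∈ Finset.range (k + 1),
          β l • (opX V i ^ (2 * l + 1)) (y (2 * l + 1))) := by
    rw [CK]
    simp only [LinearMap.add_apply, LinearMap.smul_apply, LinearMap.sum_apply, Module.End.mul_apply,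
      map_sum, map_smul]
    congr 1
    · refine Finset.sum_subset (Finset.range_subset_range.mpr (by omega)) fun l _ hl => ?_
      have : y (2 * l) = 0 := hy0 _ (by simp at hl; omega)
      change α l • (opX V i ^ (2 * l)) (y (2 * l)) = 0
      rw [this, map_zero, smul_zero]
    · congr 1
      trans ∑ l ∈ Finset.range ((k + 1) / 2),
        β l • opE V i ((opX V i ^ (2 * l + 1)) (y (2 * l + 1)))
      · refine Finset.sum_congr rfl fun l _ => ?_
        rw [hXD]
        simp only [pow_succ', Module.End.mul_apply, hβ, hy, hDdef]
      · refine Finset.sum_subset (Finset.range_subset_range.mpr (by omega)) fun l _ hl => ?_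
        have : y (2 * l + 1) = 0 := hy0 _ (by simp at hl; omega)
        rw [this, map_zero, map_zero, smul_zero]
  have hDE : ∀ z : VPoly n V, D (opE V i z) = -opE V i (D z) := by
    intro z
    rw [← Module.End.mul_apply, hDdef, dirac_mul_opE μ hi]; rfl
  have hEE : ∀ z : VPoly n V, opE V i (opE V i z) = -z := by
    intro z
    rw [← Module.End.mul_apply, opE_mul_self]; rfl
  have hTE : ∀ z : VPoly n V, opT V μ i (opE V i z) = opE V i (opT V μ i z) := by
    intro z
    rw [← Module.End.mul_apply, ← (opE_opT V μ i i).eq]; rfl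
  have hT : opT V μ i (∑ l ∈ Finset.range (k + 1), α l • (opX V i ^ (2 * l)) (y (2 * l)))
      = (1 / 2 : ℝ) • ∑ l ∈ Finset.range (k + 1),
          β l • (opX V i ^ (2 * l + 1)) (y (2 * l + 2)) := by
    rw [Finset.sum_range_succ', Finset.sum_range_succ, map_add, map_sum,
      hy0 (2 * k + 2) (by omega), map_zero, smul_zero, add_zero, mul_zero, pow_zero,
      Module.End.one_apply, map_smul, opT_eq_zero μ (hZy 0), smul_zero, add_zero, Finset.smul_sum]
    refine Finset.sum_congr rfl fun l _ => ?_
    rw [show 2 * (l + 1) = 2 * l + 1 + 1 by ring, map_smul, opT_opX_pow μ (hZy _), smul_smul, hβα,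
      smul_smul]
  rw [Iic_eq_insert_Iio, dirac_insert μ hi, LinearMap.add_apply, ← hDdef, hCK, opET,
    Module.End.mul_apply, map_add (opT V μ i), hT, map_add D, map_smul D, hDE]
  simp only [map_add, map_smul, map_sum, hTE, hEE, hXD, hDy, opT_opX_pow μ (hZy _)]
  have hα' : ∀ (l : ℕ) (z : VPoly n V),
      α l • z = (1 / 2 : ℝ) • (β l • (dunklNat (μ i) (2 * l + 1) • z)) := by
    intro l z; rw [hαβ, smul_smul, smul_smul]; congr 1; ring
  simp only [hα', smul_neg, Finset.sum_neg_distrib, ← Finset.smul_sum]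
  module

end Operators

section Operators

variable {n : ℕ} {V : Type*} [AddCommGroup V] [Module ℝ V] [Module (Cl n) V]
  [IsScalarTower ℝ (Cl n) V] (μ : Fin n → ℝ) {A B : Finset (Fin n)} {i k : Fin n}

/-! ### Eigenvalues of monogenic extensions -/

theorem sCasimir_of_dirac_eq_zero {y : VPoly n V} {g : ℝ} (hD : dirac V μ A y = 0)
    (hH : weightOp V μ A y = g • y) : sCasimir V μ A y = (g - 1 / 2) • y := by
  have h := congrArg (· y) (position_mul_dirac_self V μ A)
  simp only [Module.End.mul_apply, hD, map_zero, LinearMap.add_apply, LinearMap.sub_apply, hH,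
    LinearMap.smul_apply, Module.End.one_apply] at h
  linear_combination (norm := module) (-1 : ℝ) • h

theorem Gam_of_dirac_eq_zero {y : VPoly n V} {g σ : ℝ} (hD : dirac V μ A y = 0)
    (hH : weightOp V μ A y = g • y) (hR : opR V A y = σ • y) :
    Gam V μ A y = (σ * (g - 1 / 2)) • y := by
  rw [Gam, Module.End.mul_apply, hR, map_smul, sCasimir_of_dirac_eq_zero μ hD hH, smul_smul]

theorem weightOp_position_pow {y : VPoly n V} {g : ℝ} (hH : weightOp V μ A y = g • y) (l : ℕ) :
    weightOp V μ A ((position V A ^ l) y) = (g + l) • (position V A ^ l) y := by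
  induction l with
  | zero => simpa using hH
  | succ l ih =>
    rw [pow_succ', Module.End.mul_apply, ← Module.End.mul_apply, weightOp_mul_position,
      LinearMap.add_apply, Module.End.mul_apply, ih, map_smul]
    push_cast
    module

theorem opR_position_pow {y : VPoly n V} {σ : ℝ} (hR : opR V A y = σ • y) (l : ℕ) :
    opR V A ((position V A ^ l) y) = (σ * (-1) ^ l) • (position V A ^ l) y := by
  induction l with
  | zero => simpa using hR
  | succ l ih =>
    rw [pow_succ' (position V A), Module.End.mul_apply, ← Module.End.mul_apply,
      opR_mul_position_of_subset V (Finset.Subset.refl A),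
      LinearMap.neg_apply, Module.End.mul_apply, ih, map_smul, pow_succ]
    module

theorem sCasimir_position_pow {y : VPoly n V} {s : ℝ} (hS : sCasimir V μ A y = s • y) (l : ℕ) :
    sCasimir V μ A ((position V A ^ l) y) = (s * (-1) ^ l) • (position V A ^ l) y := by
  induction l with
  | zero => simpa using hS
  | succ l ih =>
    rw [pow_succ' (position V A), Module.End.mul_apply, ← Module.End.mul_apply,
      sCasimir_mul_position, LinearMap.neg_apply, Module.End.mul_apply, ih, map_smul, pow_succ]
    module

theorem dirac_position_pow_succ {y : VPoly n V} {g : ℝ} (hD : dirac V μ A y = 0)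
    (hH : weightOp V μ A y = g • y) (l : ℕ) :
    dirac V μ A ((position V A ^ (l + 1)) y)
      = (-((g - 1 / 2) * (-1) ^ l + (g + l) + 1 / 2)) • (position V A ^ l) y := by
  rw [pow_succ', Module.End.mul_apply, ← Module.End.mul_apply, dirac_mul_position_self]
  simp only [LinearMap.neg_apply, LinearMap.add_apply, LinearMap.smul_apply, Module.End.one_apply,
    weightOp_position_pow μ hH, sCasimir_position_pow μ (sCasimir_of_dirac_eq_zero μ hD hH)]
  module

theorem dirac_position_pow_coeff_ne_zero {g : ℝ} (hg : 0 < g) (l : ℕ) :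
    (-((g - 1 / 2) * (-1) ^ l + (g + l) + 1 / 2)) ≠ 0 := by
  have : (0 : ℝ) ≤ l := Nat.cast_nonneg l
  rcases neg_one_pow_eq_or ℝ l with h | h <;> rw [h] <;> apply ne_of_lt <;> linarith

theorem dirac_pow_position_pow {y : VPoly n V} {g : ℝ} (hD : dirac V μ A y = 0)
    (hH : weightOp V μ A y = g • y) {l m : ℕ} (h : l < m) :
    (dirac V μ A ^ m) ((position V A ^ l) y) = 0 := by
  induction m generalizing l with
  | zero => omega
  | succ m ih =>
    rw [pow_succ, Module.End.mul_apply]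
    rcases l with _ | l
    · rw [pow_zero, Module.End.one_apply, hD, map_zero]
    · rw [dirac_position_pow_succ μ hD hH, map_smul, ih (by omega), smul_zero]

/-- Eigenvectors extend to eigenvectors. -/
theorem eigen_of_restriction (hμ : 0 < μ i) (hi : i ∉ A) {Θ : Module.End ℝ (VPoly n V)}
    (h1 : Commute Θ (dirac V μ (insert i A))) (h2 : Commute Θ (opZ V i)) {F F' : VPoly n V} {c : ℝ}
    (hD : dirac V μ (insert i A) F = 0) (hD' : dirac V μ (insert i A) F' = 0)
    (hp : Θ (opZ V i F) = c • opZ V i F') : Θ F = c • F' := by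
  refine eq_of_dirac_insert μ hμ hi ?_ ?_ ?_
  · rw [← Module.End.mul_apply, ← h1.eq, Module.End.mul_apply, hD, map_zero]
  · rw [map_smul, hD', smul_zero]
  · rw [← Module.End.mul_apply, ← h2.eq, Module.End.mul_apply, hp, map_smul]

/-- The relation `[H, D] = -D` for `H = weightOp` keeps `H F` monogenic, and at `x_i = 0` the new
variable contributes `μ_i + 1/2`; uniqueness of the extension does the rest. -/
theorem weightOp_of_restriction (hμ : 0 < μ i) (hi : i ∉ A) {F p : VPoly n V} {g : ℝ}
    (hD : dirac V μ (insert i A) F = 0) (hF : opZ V i F = p) (hp : weightOp V μ A p = g • p) :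
    weightOp V μ (insert i A) F = (g + (μ i + 1 / 2)) • F := by
  refine eq_of_dirac_insert μ hμ hi ?_ ?_ ?_
  · have h := congrArg (· F) (weightOp_mul_dirac V μ (insert i A))
    simp only [Module.End.mul_apply, LinearMap.sub_apply, hD, map_zero, sub_zero] at h
    exact h.symm
  · rw [map_smul, hD, smul_zero]
  · rw [Finset.insert_eq, weightOp_union V μ (Finset.disjoint_singleton_left.mpr hi),
      LinearMap.add_apply, map_add, ← Module.End.mul_apply, opZ_mul_weightOp_singleton,
      ← Module.End.mul_apply (opZ V i) (weightOp V μ A), (opZ_commute_weightOp V μ hi).eq,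
      LinearMap.smul_apply, Module.End.mul_apply, map_smul, hF, hp]
    module

theorem opR_insert (hi : i ∉ A) : opR V (insert i A) = opR V {i} * opR V A := by
  rw [opR_mul_opR_of_disjoint V (Finset.disjoint_singleton_left.mpr hi), Finset.insert_eq]

theorem opR_singleton_commute (hi : i ∉ A) : Commute (opR V {i}) (opR V A) := by
  have h := Finset.disjoint_singleton_left.mpr hi
  change _ = _
  rw [opR_mul_opR_of_disjoint V h, opR_mul_opR_of_disjoint V h.symm, Finset.union_comm]

theorem opR_of_restriction (hμ : 0 < μ i) (hi : i ∉ A) {F p : VPoly n V} {σ : ℝ}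
    (hD : dirac V μ (insert i A) F = 0) (hF : opZ V i F = p)
    (hp : opR V A p = σ • p) : opR V (insert i A) F = σ • F := by
  refine eq_of_dirac_insert μ hμ hi ?_ ?_ ?_
  · have h := congrArg (· F) (opR_mul_dirac_of_subset V μ (Finset.Subset.refl (insert i A)))
    simp only [Module.End.mul_apply, LinearMap.neg_apply, hD, map_zero] at h
    exact neg_eq_zero.mp h.symm
  · rw [map_smul, hD, smul_zero]
  · rw [opR_insert hi, ← Module.End.mul_apply, ← mul_assoc, opZ_opR_self, (opZ_opR V i A).eq,
      Module.End.mul_apply, hF, hp, map_smul, hF]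

/-! ### The ladder operator in two blocks of variables -/

theorem opR_commute_sCasimir_self (A : Finset (Fin n)) : Commute (opR V A) (sCasimir V μ A) := by
  have hx := opR_mul_position_of_subset V (Finset.Subset.refl A)
  have hd := opR_mul_dirac_of_subset V μ (Finset.Subset.refl A)
  refine Commute.smul_right (?_ : _ = _) _
  linear_combination (norm := noncomm_ring) hx * dirac V μ A - position V A * hd
    - hd * position V A + dirac V μ A * hx

theorem opR_commute_sCasimir_of_disjoint (h : Disjoint A B) :
    Commute (opR V A) (sCasimir V μ B) := by
  have hx := opR_commute_position V h
  have hd := opR_commute_dirac V μ h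
  exact (((hx.mul_right hd).sub_right (hd.mul_right hx)).sub_right
    (Commute.one_right _)).smul_right _

/-- Conjugation by `r_i` reverses the terms of `sCasimir` that mix `x_i` with `B` and fixes the
others, so the mixed terms drop out of the anticommutator. -/
theorem Gam_mul_opR_add (hi : i ∉ B) :
    Gam V μ (insert i B) * opR V {i} + opR V {i} * Gam V μ (insert i B)
      = (2 : ℝ) • Gam V μ B + opR V {i} * opR V (insert i B)
        + (2 * μ i) • opR V (insert i B) := by
  have hd := Finset.disjoint_singleton_left.mpr hi
  have h1 := (opR_commute_sCasimir_of_disjoint (V := V) μ hd).eq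
  have h2 := opR_mul_self V ({i} : Finset (Fin n))
  have h3 := (opR_singleton_commute (V := V) hi).eq
  have h4 := opR_mul_position_of_subset V (Finset.Subset.refl {i})
  have h5 := opR_mul_dirac_of_subset V μ (Finset.Subset.refl {i})
  have h6 := (opR_commute_position V hd).eq
  have h7 := (opR_commute_dirac V μ hd).eq
  have hL : opR V {i} * (position V {i} * dirac V μ B + position V B * dirac V μ {i})
      = -((position V {i} * dirac V μ B + position V B * dirac V μ {i}) * opR V {i}) := by
    linear_combination (norm := noncomm_ring) h4 * dirac V μ B - position V {i} * h7
      + h6 * dirac V μ {i} + position V B * h5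
  rw [Gam, Gam, opR_insert hi, Finset.insert_eq, sCasimir_union V μ hd, sCasimir_singleton]
  set L := position V {i} * dirac V μ B + position V B * dirac V μ {i}
  set S := sCasimir V μ B
  set W := opR V {i}
  set r := opR V B
  have h8 : W * r * W = r := by rw [h3, mul_assoc, h2, mul_one]
  have h9 : W * (W * r) = r := by rw [← mul_assoc, h2, one_mul]
  have h10 : W * (S * (W * r)) = S * r := by rw [← mul_assoc, h1, mul_assoc, h9]
  have h11 : W * (L * (W * r)) = -(L * r) := by
    rw [← mul_assoc, hL, neg_mul, mul_assoc, h9]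
  have h12 : W * (W * (W * r)) = W * r := by rw [h9]
  simp only [add_mul, mul_add, mul_assoc] at h8 ⊢
  simp only [smul_mul_assoc, mul_smul_comm, h8, h9, h10, h11, one_mul]
  module

variable (V i) in
/-- The operator that exchanges the eigenvalues `lam` and `σ - lam` of `Γ_{B ∪ {i}}`, on vectors
of parity `σ` on which `Γ_B` acts as `lam1`. -/
def ladder (lam lam1 σ : ℝ) : Module.End ℝ (VPoly n V) :=
  (lam - σ / 2) • opR V {i} - (lam1 + σ * μ i) • 1

theorem opZ_mul_ladder (lam lam1 σ : ℝ) :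
    opZ V i * ladder V μ i lam lam1 σ = (lam - σ / 2 - lam1 - σ * μ i) • opZ V i := by
  rw [ladder, mul_sub, mul_smul_comm, mul_smul_comm, opZ_opR_self, mul_one]
  module

/-- By the anticommutator, `Γ` sends `r_i p` to `(σ - lam) r_i p + 2 (lam1 + σ μ_i) p`, so it is
triangular on `p` and `r_i p`; `ladder` picks the combination with eigenvalue `σ - lam`. -/
theorem Gam_ladder (hi : i ∉ B) {p : VPoly n V} {lam lam1 σ : ℝ}
    (hA : Gam V μ (insert i B) p = lam • p) (hB : Gam V μ B p = lam1 • p)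
    (hR : opR V (insert i B) p = σ • p) :
    Gam V μ (insert i B) (ladder V μ i lam lam1 σ p)
      = (σ - lam) • ladder V μ i lam lam1 σ p := by
  have h := congrArg (· p) (Gam_mul_opR_add (V := V) μ hi)
  simp only [Module.End.mul_apply, LinearMap.add_apply, LinearMap.smul_apply, hA, hB, hR,
    map_smul] at h
  have h2 := eq_sub_of_add_eq h
  simp only [ladder, LinearMap.sub_apply, LinearMap.smul_apply, Module.End.one_apply, map_sub,
    map_smul, hA, h2]
  module

/-- The difference of the two sides is an eigenvector of `Γ_{B∪i}` that vanishes at `x_i = 0`. The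
factor `c` in `hZ` admits the degenerate case `c = 0`, `p' = 0`. -/
theorem ladder_eq (hμ : 0 < μ i) (hi : i ∉ B) (hBne : B.Nonempty) {p p' : VPoly n V}
    {lam lam1 σ c : ℝ} (hA : Gam V μ (insert i B) p = lam • p) (hB : Gam V μ B p = lam1 • p)
    (hR : opR V (insert i B) p = σ • p) (hc : c = lam - σ / 2 - lam1 - σ * μ i)
    (hA' : Gam V μ (insert i B) p' = (σ - lam) • p') (hZ : c • opZ V i p' = c • opZ V i p) :
    ladder V μ i lam lam1 σ p = c • p' := by
  rw [← sub_eq_zero]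
  refine eq_zero_of_Gam_insert μ hμ hi hBne (c := σ - lam) ?_ ?_
  · rw [map_sub, Gam_ladder μ hi hA hB hR, map_smul, hA', smul_sub, smul_comm]
  · rw [map_sub, map_smul, hZ, ← Module.End.mul_apply, opZ_mul_ladder, hc, LinearMap.smul_apply,
      sub_self]

/-! ### The ladder operators of the symmetry algebra -/

variable (V) in
/-- The operator `K` for the three blocks of variables `B`, `{i}`, `{k}`. -/
def blockK (ε : ℝ) (B : Finset (Fin n)) (i k : Fin n) : Module.End ℝ (VPoly n V) :=
  (Gam V μ {i, k} + ε • Gam V μ (insert k B)) * (Gam V μ (insert i B) - (ε / 2) • 1)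
  - (Gam V μ {k} + ε • Gam V μ (insert k (insert i B))) * (Gam V μ B + ε • Gam V μ {i})

theorem blockK_commute {Θ : Module.End ℝ (VPoly n V)} (ε : ℝ)
    (h : ∀ A ⊆ insert k (insert i B), Commute (Gam V μ A) Θ) :
    Commute (blockK V μ ε B i k) Θ := by
  have hB : B ⊆ insert k (insert i B) :=
    (Finset.subset_insert _ _).trans (Finset.subset_insert _ _)
  refine Commute.sub_left (Commute.mul_left (Commute.add_left (h _ ?_) ((h _ ?_).smul_left _))
    (Commute.sub_left (h _ ?_) ((Commute.one_left _).smul_left _)))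
    (Commute.mul_left (Commute.add_left (h _ ?_) ((h _ ?_).smul_left _))
    (Commute.add_left (h _ ?_) ((h _ ?_).smul_left _)))
  · intro x; simp only [Finset.mem_insert, Finset.mem_singleton]; tauto
  · exact Finset.insert_subset_insert _ (Finset.subset_insert _ _)
  · exact Finset.subset_insert _ _
  · simp
  · exact Finset.Subset.refl _
  · exact hB
  · simp

/-! ### The restriction of `K` to `x_k = 0`. -/

/-- At `x_k = 0` the term with `e_k x_k` disappears, `r_k` becomes trivial, and monogenicity
replaces `e_k T_k F` by `-D_A F`. The result depends on `p` alone. -/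
theorem opZ_Gam_insert {E : Finset (Fin n)} (hE : E ⊆ A) (hk : k ∉ A) {F p : VPoly n V}
    (hD : dirac V μ (insert k A) F = 0) (hF : opZ V k F = p) :
    opZ V k (Gam V μ (insert k E) F)
      = opR V E (sCasimir V μ E p + (μ k + 1 / 2) • p - position V E (dirac V μ A p)) := by
  have hkE : k ∉ E := fun h => hk (hE h)
  have hdk : opET V μ k F = -dirac V μ A F := by
    rw [dirac_insert μ hk, LinearMap.add_apply] at hD
    exact eq_neg_of_add_eq_zero_left hD
  rw [Gam, ← (opR_commute_sCasimir_self μ _).eq, opR_insert hkE, ← Module.End.mul_apply,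
    ← mul_assoc, ← mul_assoc, opZ_opR_self, (opZ_opR V k E).eq, mul_assoc, Module.End.mul_apply]
  congr 1
  rw [Finset.insert_eq, sCasimir_union V μ (Finset.disjoint_singleton_left.mpr hkE),
    sCasimir_singleton, position_singleton, dirac_singleton]
  simp only [mul_add, LinearMap.add_apply, mul_smul_comm, opZ_opR_self, ← mul_assoc, opZ_opEX_self,
    zero_mul, mul_one, (opZ_commute_sCasimir V μ hkE).eq, (opZ_commute_position V hkE).eq]
  simp only [Module.End.mul_apply, LinearMap.smul_apply, hF, hdk, map_neg, LinearMap.zero_apply]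
  rw [← Module.End.mul_apply (opZ V k), (opZ_commute_dirac V μ hk).eq, Module.End.mul_apply, hF]
  module

/-- The data on a monogenic extension `F` of `p` that determine the action of `K`. -/
structure IsExtension (B : Finset (Fin n)) (i k : Fin n) (lam lam1 h σ : ℝ) (F p : VPoly n V) :
    Prop where
  monogenic : dirac V μ (insert k (insert i B)) F = 0
  restrict : opZ V k F = p
  gam_insert : Gam V μ (insert i B) p = lam • p
  gam : Gam V μ B p = lam1 • p
  weight : weightOp V μ (insert i B) p = (h + 1 / 2) • p
  parity : opR V (insert i B) p = σ • p

variable {lam lam1 h σ : ℝ} {F p : VPoly n V}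

theorem IsExtension.position_dirac (hF : IsExtension μ B i k lam lam1 h σ F p) (hσ : σ * σ = 1) :
    position V (insert i B) (dirac V μ (insert i B) p) = (σ * lam - h) • p := by
  have hS : sCasimir V μ (insert i B) p = (σ * lam) • p := by
    have h1 := hF.gam_insert
    rw [Gam, Module.End.mul_apply, hF.parity, map_smul] at h1
    rw [mul_smul, ← h1, smul_smul, hσ, one_smul]
  rw [← Module.End.mul_apply, position_mul_dirac_self]
  simp only [LinearMap.add_apply, LinearMap.sub_apply, LinearMap.smul_apply, Module.End.one_apply,
    hS, hF.weight]
  module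

theorem IsExtension.opZ_blockK (hF : IsExtension μ B i k lam lam1 h σ F p) (hμ : 0 < μ k)
    (hi : i ∉ B) (hk : k ∉ insert i B) (ε : ℝ) :
    opZ V k (blockK V μ ε B i k F)
      = (lam - ε / 2) • ((μ i + ε * lam1) • p + ((1 + ε * σ) * (μ k + 1 / 2)) • opR V {i} p
          - opR V {i} (opEX V i (dirac V μ (insert i B) p))
          - (ε * σ) • opR V {i} (position V B (dirac V μ (insert i B) p)))
        - ((μ k + ε * (σ * (h + μ k + 1 / 2))) * (lam1 + ε * μ i)) • p := by
  have hZ : ∀ {A}, A ⊆ insert i B → Commute (Gam V μ A) (opZ V k) := fun hA =>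
    (opZ_commute_Gam V μ fun h => hk (hA h)).symm
  have hΓ : ∀ {A} {c : ℝ}, A ⊆ insert i B → Gam V μ A p = c • p → Gam V μ A F = c • F := by
    intro A c hA hp
    refine eigen_of_restriction μ hμ hk
      (Gam_commute_dirac V μ (hA.trans (Finset.subset_insert _ _))) (hZ hA) hF.monogenic hF.monogenic ?_
    rw [hF.restrict, hp]
  have h1 := hΓ (Finset.Subset.refl _) hF.gam_insert
  have h2 := hΓ (Finset.subset_insert i B) hF.gam
  -- The weight of `F` is `(h + 1/2) + (μ_k + 1/2)`, and a monogenic of weight `w` has `sCasimir`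
  -- eigenvalue `w - 1/2`.
  have h3 : Gam V μ (insert k (insert i B)) F = (σ * (h + μ k + 1 / 2)) • F := by
    rw [Gam_of_dirac_eq_zero μ hF.monogenic
      (weightOp_of_restriction μ hμ hk hF.monogenic hF.restrict hF.weight)
      (opR_of_restriction μ hμ hk hF.monogenic hF.restrict hF.parity)]
    congr 1; ring
  have h4 : opZ V k (Gam V μ {i, k} F) = μ i • p + (μ k + 1 / 2) • opR V {i} p
      - opR V {i} (opEX V i (dirac V μ (insert i B) p)) := by
    rw [Finset.pair_comm, opZ_Gam_insert μ (Finset.singleton_subset_iff.mpr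
      (Finset.mem_insert_self i B)) hk hF.monogenic hF.restrict, position_singleton,
      sCasimir_singleton, map_sub, map_add, LinearMap.smul_apply, map_smul, map_smul,
      ← Module.End.mul_apply (opR V {i}) (opR V {i}), opR_mul_self, Module.End.one_apply]
  have h5 : opZ V k (Gam V μ (insert k B) F) = lam1 • p + (σ * (μ k + 1 / 2)) • opR V {i} p
      - σ • opR V {i} (position V B (dirac V μ (insert i B) p)) := by
    have h6 : opR V B = opR V {i} * opR V (insert i B) := by
      rw [opR_insert hi, ← mul_assoc, opR_mul_self, one_mul]
    have h7 : opR V B (sCasimir V μ B p) = lam1 • p := by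
      rw [← Module.End.mul_apply, (opR_commute_sCasimir_self μ B).eq]
      exact hF.gam
    have h8 : opR V (insert i B) (position V B (dirac V μ (insert i B) p))
        = σ • position V B (dirac V μ (insert i B) p) := by
      rw [← Module.End.mul_apply, opR_mul_position_of_subset V (Finset.subset_insert i B),
        LinearMap.neg_apply, Module.End.mul_apply, ← Module.End.mul_apply (opR V _) (dirac V μ _),
        opR_mul_dirac_of_subset V μ (Finset.Subset.refl _), LinearMap.neg_apply,
        Module.End.mul_apply, hF.parity, map_smul, map_neg, map_smul, neg_neg]
    rw [opZ_Gam_insert μ (Finset.subset_insert i B) hk hF.monogenic hF.restrict, map_sub, map_add, h7,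
      map_smul, h6]
    simp only [Module.End.mul_apply, hF.parity, h8, map_smul, smul_smul]
    rw [mul_comm σ]
  rw [blockK]
  simp only [LinearMap.sub_apply, Module.End.mul_apply, LinearMap.add_apply, LinearMap.smul_apply,
    Module.End.one_apply, h1, h2, Gam_singleton, map_add, map_sub, map_smul, h3, h4, h5,
    hF.restrict]
  module

/-- For sign `σ` the terms with `e_i x_i` and `x_B` have equal coefficients and add up to `x_{B∪i} D
p`, a multiple of `p`; only `p` and `r_i p` remain. -/
theorem IsExtension.opZ_blockK_pos (hF : IsExtension μ B i k lam lam1 h σ F p) (hμ : 0 < μ k)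
    (hi : i ∉ B) (hk : k ∉ insert i B) (hσ : σ * σ = 1) :
    opZ V k (blockK V μ σ B i k F)
      = (2 * μ k + 1 + h - σ * lam) • ladder V μ i lam lam1 σ p := by
  have h1 := congrArg (opR V {i}) (hF.position_dirac μ hσ)
  rw [position_insert hi, LinearMap.add_apply, map_add, map_smul] at h1
  have h2 := eq_sub_of_add_eq h1
  rw [hF.opZ_blockK μ hμ hi hk, hσ, h2, ladder]
  simp only [LinearMap.sub_apply, LinearMap.smul_apply, Module.End.one_apply]
  have h3 : σ * (σ * (h + μ k + 1 / 2)) = h + μ k + 1 / 2 := by rw [← mul_assoc, hσ, one_mul]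
  rw [h3]
  match_scalars
  · linear_combination (-lam * μ i - lam1 / 2) * hσ
  all_goals ring

/-- For sign `-σ` the term `r_i p` cancels. Moving `r_i` past `e_i x_i` (with a sign) and past `x_B`
(without) gives the two position terms equal coefficients, so `x_{B∪i}` factors out once the
multiples of `p` are matched with `x_{B∪i} D p`. -/
theorem IsExtension.opZ_blockK_neg (hF : IsExtension μ B i k lam lam1 h σ F p) (hμ : 0 < μ k)
    (hi : i ∉ B) (hk : k ∉ insert i B) (hσ : σ * σ = 1) :
    opZ V k (blockK V μ (-σ) B i k F)
      = position V (insert i B) (ladder V μ i lam lam1 (-σ) (dirac V μ (insert i B) p)) := by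
  have h1 := hF.position_dirac μ hσ
  have hx : ∀ y : VPoly n V, opR V {i} (opEX V i y) = -opEX V i (opR V {i} y) := by
    intro y
    rw [← position_singleton, ← Module.End.mul_apply,
      opR_mul_position_of_subset V (Finset.Subset.refl _)]; rfl
  have hxB : ∀ y : VPoly n V, opR V {i} (position V B y) = position V B (opR V {i} y) := by
    intro y
    rw [← Module.End.mul_apply,
      (opR_commute_position V (Finset.disjoint_singleton_left.mpr hi)).eq]; rfl
  rw [hF.opZ_blockK μ hμ hi hk, neg_mul σ σ, hσ, ladder, hx, hxB]
  simp only [LinearMap.sub_apply, LinearMap.smul_apply, Module.End.one_apply, map_sub, map_smul, h1]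
  rw [position_insert hi, LinearMap.add_apply]
  match_scalars
  · linear_combination
      (lam1 * (μ k + h) - lam * μ i - σ * μ i * (1 / 2 + μ k + h)) * hσ
  all_goals ring

end Operators

section Operators

variable {n : ℕ} {V : Type*} [AddCommGroup V] [Module ℝ V] [Module (Cl n) V]
  [IsScalarTower ℝ (Cl n) V] (μ : Fin n → ℝ) {B : Finset (Fin n)} {i k : Fin n}

/-! ### The action of `K` on two consecutive extensions -/

/-- Two consecutive monogenic extensions, in the variables `x_i` and `x_k`, that start from a
monogenic `M` in the variables of the block `B`. -/
structure IsLadder (B : Finset (Fin n)) (i k : Fin n) (g δ : ℝ) (M : VPoly n V)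
    (q : ℕ → VPoly n V) (F : ℕ → ℕ → VPoly n V) : Prop where
  monogenic_base : dirac V μ B M = 0
  weight : weightOp V μ B M = g • M
  parity : opR V B M = δ • M
  monogenic : ∀ j, dirac V μ (insert i B) (q j) = 0
  restrict : ∀ j, opZ V i (q j) = (position V B ^ j) M
  monogenic_top : ∀ j l, dirac V μ (insert k (insert i B)) (F j l) = 0
  restrict_top : ∀ j l, opZ V k (F j l) = (position V (insert i B) ^ l) (q j)

theorem opZ_position_insert_pow (hi : i ∉ B) (l : ℕ) :
    opZ V i * position V (insert i B) ^ l = position V B ^ l * opZ V i := by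
  induction l with
  | zero => simp
  | succ l ih =>
    rw [pow_succ, ← mul_assoc, ih, pow_succ, mul_assoc, mul_assoc, position_insert hi, mul_add,
      opZ_opEX_self, zero_add, (opZ_commute_position V hi).eq]

variable {g δ : ℝ} {M : VPoly n V} {q : ℕ → VPoly n V} {F : ℕ → ℕ → VPoly n V}

namespace IsLadder

theorem weight_insert (hL : IsLadder μ B i k g δ M q F) (hμ : 0 < μ i) (hi : i ∉ B) (j : ℕ) :
    weightOp V μ (insert i B) (q j) = (g + j + (μ i + 1 / 2)) • q j :=
  weightOp_of_restriction μ hμ hi (hL.monogenic j) (hL.restrict j)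
    (weightOp_position_pow μ hL.weight j)

theorem parity_insert (hL : IsLadder μ B i k g δ M q F) (hμ : 0 < μ i) (hi : i ∉ B) (j : ℕ) :
    opR V (insert i B) (q j) = (δ * (-1) ^ j) • q j :=
  opR_of_restriction μ hμ hi (hL.monogenic j) (hL.restrict j) (opR_position_pow hL.parity j)

theorem gam_base (hL : IsLadder μ B i k g δ M q F) (hμ : 0 < μ i) (hi : i ∉ B) (j : ℕ) :
    Gam V μ B (q j) = (δ * (g - 1 / 2)) • q j := by
  refine eigen_of_restriction μ hμ hi (Gam_commute_dirac V μ (Finset.subset_insert i B))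
    (opZ_commute_Gam V μ hi).symm (hL.monogenic j) (hL.monogenic j) ?_
  rw [hL.restrict, ← Module.End.mul_apply, ((Gam_commute_position_self V μ B).pow_right j).eq,
    Module.End.mul_apply, Gam_of_dirac_eq_zero μ hL.monogenic_base hL.weight hL.parity, map_smul]

theorem isExtension (hL : IsLadder μ B i k g δ M q F) (hμ : 0 < μ i) (hi : i ∉ B) (j l : ℕ) :
    IsExtension μ B i k (δ * (-1) ^ j * (g + j + μ i)) (δ * (g - 1 / 2)) (g + j + l + μ i)
      (δ * (-1) ^ (j + l)) (F j l) ((position V (insert i B) ^ l) (q j)) where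
  monogenic := hL.monogenic_top j l
  restrict := hL.restrict_top j l
  gam_insert := by
    rw [← Module.End.mul_apply, ((Gam_commute_position_self V μ _).pow_right l).eq,
      Module.End.mul_apply, Gam_of_dirac_eq_zero μ (hL.monogenic j) (hL.weight_insert μ hμ hi j)
      (hL.parity_insert μ hμ hi j), map_smul]
    congr 1; ring
  gam := by
    rw [← Module.End.mul_apply,
      ((Gam_commute_position V μ (Finset.subset_insert i B)).pow_right l).eq,
      Module.End.mul_apply, hL.gam_base μ hμ hi, map_smul]
  weight := by
    rw [weightOp_position_pow μ (hL.weight_insert μ hμ hi j)]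
    congr 1; ring
  parity := by
    rw [opR_position_pow (hL.parity_insert μ hμ hi j), pow_add, mul_assoc]

end IsLadder

/-- The factor by which the ladder operator acts. -/
def ladderCoeff (m g δ : ℝ) (j l : ℕ) : ℝ :=
  δ * (-1) ^ j * (g + j + m) - δ * (-1) ^ (j + l) / 2 - δ * (g - 1 / 2) - δ * (-1) ^ (j + l) * m

theorem ladderCoeff_zero_of_even {m g δ : ℝ} {l : ℕ} (hl : Even l) : ladderCoeff m g δ 0 l = 0 := by
  simp only [ladderCoeff, zero_add, hl.neg_one_pow]
  push_cast; ring

theorem ladderCoeff_ne_zero {m g δ : ℝ} (hm : 0 < m) (hg : 1 / 2 < g) (hδ : δ * δ = 1) {j l : ℕ}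
    (h : Odd l ∨ 0 < j) : ladderCoeff m g δ j l ≠ 0 := by
  have hδ0 : δ ≠ 0 := by rintro rfl; simp at hδ
  have hj : (0 : ℝ) ≤ j := Nat.cast_nonneg j
  -- Up to a sign and `δ`, the factor is `j`, `2g + j - 1`, `j + 1 + 2m` or `j + 2g + 2m`, according
  -- to the parities of `l` and `j`.
  have key : ∃ x : ℝ, 0 < x ∧ (ladderCoeff m g δ j l = δ * x ∨ ladderCoeff m g δ j l = -(δ * x)) := by
    rcases Nat.even_or_odd l with hl | hl
    · have hj' : (0 : ℝ) < j := by
        rcases h with h | h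
        · exact absurd hl (Nat.not_even_iff_odd.mpr h)
        · exact_mod_cast h
      rcases Nat.even_or_odd j with hje | hje
      · refine ⟨j, hj', Or.inl ?_⟩
        simp only [ladderCoeff, pow_add, hl.neg_one_pow, hje.neg_one_pow]; ring
      · refine ⟨2 * g + j - 1, by linarith, Or.inr ?_⟩
        simp only [ladderCoeff, pow_add, hl.neg_one_pow, hje.neg_one_pow]; ring
    · rcases Nat.even_or_odd j with hje | hje
      · refine ⟨j + 1 + 2 * m, by linarith, Or.inl ?_⟩
        simp only [ladderCoeff, pow_add, hl.neg_one_pow, hje.neg_one_pow]; ring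
      · refine ⟨j + 2 * g + 2 * m, by linarith, Or.inr ?_⟩
        simp only [ladderCoeff, pow_add, hl.neg_one_pow, hje.neg_one_pow]; ring
  obtain ⟨x, hx, h | h⟩ := key <;> rw [h]
  · exact mul_ne_zero hδ0 hx.ne'
  · exact neg_ne_zero.mpr (mul_ne_zero hδ0 hx.ne')

/-- The subtracted product is `(-1)^l (g + j + m)`, so the expression is at least `2 * mk + 1 + l`.
-/
theorem scale_ne_zero {m mk g δ : ℝ} (hm : 0 < m) (hk : 0 < mk) (hg : 1 / 2 < g) (hδ : δ * δ = 1)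
    (j l : ℕ) :
    2 * mk + 1 + (g + j + l + m) - δ * (-1) ^ (j + l) * (δ * (-1) ^ j * (g + j + m)) ≠ 0 := by
  have hj : (0 : ℝ) ≤ j := Nat.cast_nonneg j
  have hl : (0 : ℝ) ≤ l := Nat.cast_nonneg l
  have h : δ * (-1) ^ (j + l) * (δ * (-1) ^ j * (g + j + m)) = (-1) ^ l * (g + j + m) := by
    have h1 : ((-1 : ℝ) ^ j) * (-1) ^ j = 1 := by rw [← pow_add, Even.neg_one_pow ⟨j, rfl⟩]
    rw [pow_add]
    linear_combination ((-1 : ℝ) ^ j * (-1) ^ j * (-1) ^ l * (g + j + m)) * hδ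
      + ((-1) ^ l * (g + j + m)) * h1
  rw [h]
  apply ne_of_gt
  rcases neg_one_pow_eq_or ℝ l with h | h <;> rw [h] <;> linarith

namespace IsLadder

/-- Multiplied by `δ`, the hypothesis `hs` says `λ_{j'} = σ - λ_j`; `hjl` makes both polynomials
restrict to the same power of `x_B` applied to `M`. -/
theorem ladder_apply (hL : IsLadder μ B i k g δ M q F) (hμ : 0 < μ i) (hi : i ∉ B)
    (hB : B.Nonempty) {j l j' l' : ℕ} (hjl : j' + l' = j + l)
    (hs : (-1 : ℝ) ^ j' * (g + j' + μ i) = (-1) ^ (j + l) - (-1) ^ j * (g + j + μ i)) :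
    ladder V μ i (δ * (-1) ^ j * (g + j + μ i)) (δ * (g - 1 / 2)) (δ * (-1) ^ (j + l))
        ((position V (insert i B) ^ l) (q j))
      = ladderCoeff (μ i) g δ j l • (position V (insert i B) ^ l') (q j') := by
  have h1 := hL.isExtension μ hμ hi j l
  refine ladder_eq μ hμ hi hB h1.gam_insert h1.gam h1.parity rfl ?_ ?_
  · rw [(hL.isExtension μ hμ hi j' l').gam_insert]
    congr 1
    linear_combination δ * hs
  · simp only [← Module.End.mul_apply (opZ V i), opZ_position_insert_pow hi]
    simp only [Module.End.mul_apply, hL.restrict]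
    simp only [← Module.End.mul_apply, ← pow_add]
    rw [add_comm l', hjl, add_comm j]

theorem ladder_apply_zero (hL : IsLadder μ B i k g δ M q F) (hμ : 0 < μ i) (hi : i ∉ B)
    (hB : B.Nonempty) {l : ℕ} (hl : Even l) :
    ladder V μ i (δ * (-1) ^ 0 * (g + (0 : ℕ) + μ i)) (δ * (g - 1 / 2)) (δ * (-1) ^ (0 + l))
        ((position V (insert i B) ^ l) (q 0)) = 0 := by
  have h1 := hL.isExtension μ hμ hi 0 l
  refine (ladder_eq μ hμ hi hB h1.gam_insert h1.gam h1.parity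
    (ladderCoeff_zero_of_even (m := μ i) (g := g) (δ := δ) hl).symm (p' := 0) ?_ ?_).trans
    (zero_smul ℝ _)
  · rw [map_zero, smul_zero]
  · rw [zero_smul, zero_smul]

theorem blockK_eq (hL : IsLadder μ B i k g δ M q F) (hμ : 0 < μ k) (hk : k ∉ insert i B)
    {ε c : ℝ} {j l j' l' : ℕ}
    (h : opZ V k (blockK V μ ε B i k (F j l)) = c • (position V (insert i B) ^ l') (q j')) :
    blockK V μ ε B i k (F j l) = c • F j' l' := by
  refine eq_of_dirac_insert μ hμ hk ?_ ?_ ?_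
  · rw [← Module.End.mul_apply, ← (blockK_commute μ ε fun A hA => Gam_commute_dirac V μ hA).eq,
      Module.End.mul_apply, hL.monogenic_top, map_zero]
  · rw [map_smul, hL.monogenic_top, smul_zero]
  · rw [h, map_smul, hL.restrict_top]

theorem blockK_eq_zero (hL : IsLadder μ B i k g δ M q F) (hμ : 0 < μ k) (hk : k ∉ insert i B)
    {ε : ℝ} {j l : ℕ} (h : opZ V k (blockK V μ ε B i k (F j l)) = 0) :
    blockK V μ ε B i k (F j l) = 0 := by
  rw [hL.blockK_eq μ hμ hk (c := 0) (j' := 0) (l' := 0) (by rw [h, zero_smul]), zero_smul]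

theorem dirac_succ (hL : IsLadder μ B i k g δ M q F) (hμ : 0 < μ i) (hi : i ∉ B) (j l : ℕ) :
    dirac V μ (insert i B) ((position V (insert i B) ^ (l + 1)) (q j))
      = (-((g + j + (μ i + 1 / 2) - 1 / 2) * (-1) ^ l + (g + j + (μ i + 1 / 2) + l) + 1 / 2))
        • (position V (insert i B) ^ l) (q j) :=
  dirac_position_pow_succ μ (hL.monogenic j) (hL.weight_insert μ hμ hi j) l

end IsLadder

theorem mul_neg_one_pow_mul_self (hδ : δ * δ = 1) (j : ℕ) :
    δ * (-1) ^ j * (δ * (-1) ^ j) = 1 := by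
  have h1 : ((-1 : ℝ) ^ j) * (-1) ^ j = 1 := by rw [← pow_add, Even.neg_one_pow ⟨j, rfl⟩]
  linear_combination ((-1 : ℝ) ^ j * (-1) ^ j) * hδ + h1

/-! ### Lowering and raising the exponents. -/

variable (B i k g δ)

/-- The constant depends only on weights, parities and exponents. It is fixed before `M`, which
later makes it independent of the vector `v`. -/
theorem exists_blockK_pos (hμi : 0 < μ i) (hμk : 0 < μ k) (hi : i ∉ B) (hk : k ∉ insert i B)
    (hB : B.Nonempty) (hg : 1 / 2 < g) (hδ : δ * δ = 1) {j l j' l' : ℕ} (h : Odd l ∨ 0 < j)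
    (hjl : j' + l' = j + l)
    (hs : (-1 : ℝ) ^ j' * (g + j' + μ i) = (-1) ^ (j + l) - (-1) ^ j * (g + j + μ i)) :
    ∃ c : ℝ, c ≠ 0 ∧ ∀ (M : VPoly n V) q F, IsLadder μ B i k g δ M q F →
      blockK V μ (δ * (-1) ^ (j + l)) B i k (F j l) = c • F j' l' := by
  refine ⟨_, mul_ne_zero (scale_ne_zero hμi hμk hg hδ j l) (ladderCoeff_ne_zero hμi hg hδ h),
    fun M q F hL => hL.blockK_eq μ hμk hk ?_⟩
  rw [(hL.isExtension μ hμi hi j l).opZ_blockK_pos μ hμk hi hk (mul_neg_one_pow_mul_self hδ _),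
    hL.ladder_apply μ hμi hi hB hjl hs, smul_smul]

/-- The sign is opposite to the parity of `F j (l + 1)`: `D` removes one factor `x_{B∪i}`, the
ladder step takes place at `(j, l)`, and the factor is then restored. -/
theorem exists_blockK_neg (hμi : 0 < μ i) (hμk : 0 < μ k) (hi : i ∉ B) (hk : k ∉ insert i B)
    (hB : B.Nonempty) (hg : 1 / 2 < g) (hδ : δ * δ = 1) {j l j' l' : ℕ} (h : Odd l ∨ 0 < j)
    (hjl : j' + l' = j + l)
    (hs : (-1 : ℝ) ^ j' * (g + j' + μ i) = (-1) ^ (j + l) - (-1) ^ j * (g + j + μ i)) :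
    ∃ c : ℝ, c ≠ 0 ∧ ∀ (M : VPoly n V) q F, IsLadder μ B i k g δ M q F →
      blockK V μ (δ * (-1) ^ (j + l)) B i k (F j (l + 1)) = c • F j' (l' + 1) := by
  refine ⟨_, mul_ne_zero (dirac_position_pow_coeff_ne_zero (g := g + j + (μ i + 1 / 2))
    (by positivity) l) (ladderCoeff_ne_zero hμi hg hδ h), fun M q F hL => hL.blockK_eq μ hμk hk ?_⟩
  have h := (hL.isExtension μ hμi hi j (l + 1)).opZ_blockK_neg μ hμk hi hk
    (mul_neg_one_pow_mul_self hδ _)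
  have hsign : -(δ * (-1) ^ (j + (l + 1))) = δ * (-1 : ℝ) ^ (j + l) := by ring
  rw [hL.dirac_succ μ hμi hi, map_smul, map_smul, hsign, hL.ladder_apply μ hμi hi hB hjl hs,
    map_smul, smul_smul, ← Module.End.mul_apply (position V _), ← pow_succ'] at h
  exact h

theorem neg_one_pow_add_even {l : ℕ} (hl : Even l) (j : ℕ) : (-1 : ℝ) ^ (j + l) = (-1) ^ j := by
  rw [pow_add, hl.neg_one_pow, mul_one]

theorem neg_one_pow_add_odd {l : ℕ} (hl : Odd l) (j : ℕ) :
    (-1 : ℝ) ^ (j + l) = (-1) ^ (j + 1) := by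
  rw [pow_add, hl.neg_one_pow, pow_succ]

/-- `K` with the sign of the eigenvalue of `Γ_{B ∪ {i}}` lowers the first exponent. -/
theorem exists_blockK_lower (hμi : 0 < μ i) (hμk : 0 < μ k) (hi : i ∉ B) (hk : k ∉ insert i B)
    (hB : B.Nonempty) (hg : 1 / 2 < g) (hδ : δ * δ = 1) (j l : ℕ) :
    ∃ c : ℝ, c ≠ 0 ∧ ∀ (M : VPoly n V) q F, IsLadder μ B i k g δ M q F →
      blockK V μ (δ * (-1) ^ (j + 1)) B i k (F (j + 1) l) = c • F j (l + 1) := by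
  have hs : ∀ {l : ℕ}, Even l → (-1 : ℝ) ^ j * (g + j + μ i)
      = (-1) ^ (j + 1 + l) - (-1) ^ (j + 1) * (g + (j + 1 : ℕ) + μ i) := by
    intro l hl
    rw [neg_one_pow_add_even hl]; push_cast; ring
  -- The sign is the parity of `F (j + 1) l` for even `l` and its opposite for odd `l`. Either way
  -- the ladder step occurs at an even exponent, which lowers `j`.
  rcases Nat.even_or_odd l with hl | hl
  · have h := exists_blockK_pos (V := V) μ B i k g δ hμi hμk hi hk hB hg hδ (Or.inr j.succ_pos)
      (by ring : j + (l + 1) = j + 1 + l) (hs hl)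
    rwa [neg_one_pow_add_even hl] at h
  · obtain ⟨t, rfl⟩ := hl
    have ht : Even (2 * t) := even_two_mul t
    have h := exists_blockK_neg (V := V) μ B i k g δ hμi hμk hi hk hB hg hδ (Or.inr j.succ_pos)
      (by ring : j + (2 * t + 1) = j + 1 + 2 * t) (hs ht)
    rwa [neg_one_pow_add_even ht] at h

/-- `K` with the sign opposite to that of the eigenvalue of `Γ_{B ∪ {i}}` raises the first
exponent. -/
theorem exists_blockK_raise (hμi : 0 < μ i) (hμk : 0 < μ k) (hi : i ∉ B) (hk : k ∉ insert i B)
    (hB : B.Nonempty) (hg : 1 / 2 < g) (hδ : δ * δ = 1) (j l : ℕ) :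
    ∃ c : ℝ, c ≠ 0 ∧ ∀ (M : VPoly n V) q F, IsLadder μ B i k g δ M q F →
      blockK V μ (δ * (-1) ^ (j + 1)) B i k (F j (l + 1)) = c • F (j + 1) l := by
  have hs : ∀ {l : ℕ}, Odd l → (-1 : ℝ) ^ (j + 1) * (g + (j + 1 : ℕ) + μ i)
      = (-1) ^ (j + l) - (-1) ^ j * (g + j + μ i) := by
    intro l hl
    rw [neg_one_pow_add_odd hl]; push_cast; ring
  -- The ladder step occurs at an odd exponent: at `l + 1` for even `l`, and at `l`, after `D` has
  -- removed one factor, for odd `l`.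
  rcases Nat.even_or_odd l with hl | hl
  · have h := exists_blockK_pos (V := V) μ B i k g δ hμi hμk hi hk hB hg hδ (Or.inl hl.add_one)
      (by ring : j + 1 + l = j + (l + 1)) (hs hl.add_one)
    rwa [neg_one_pow_add_odd hl.add_one] at h
  · obtain ⟨t, rfl⟩ : ∃ t, l = t + 1 := ⟨l - 1, by have := hl.pos; omega⟩
    have h := exists_blockK_neg (V := V) μ B i k g δ hμi hμk hi hk hB hg hδ (Or.inl hl)
      (by ring : j + 1 + t = j + (t + 1)) (hs hl)
    rwa [neg_one_pow_add_odd hl] at h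

variable {B i k g δ}

/-- The ladder step would occur at `j = 0` and an even exponent, exactly where `ladderCoeff`
vanishes. -/
theorem IsLadder.blockK_lower_zero (hL : IsLadder μ B i k g δ M q F) (hμi : 0 < μ i)
    (hμk : 0 < μ k) (hi : i ∉ B) (hk : k ∉ insert i B) (hB : B.Nonempty) (hδ : δ * δ = 1)
    (l : ℕ) : blockK V μ δ B i k (F 0 l) = 0 := by
  refine hL.blockK_eq_zero μ hμk hk ?_
  rcases Nat.even_or_odd l with hl | hl
  · have h := (hL.isExtension μ hμi hi 0 l).opZ_blockK_pos μ hμk hi hk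
      (mul_neg_one_pow_mul_self hδ _)
    rw [hL.ladder_apply_zero μ hμi hi hB hl, smul_zero, neg_one_pow_add_even hl, pow_zero,
      mul_one] at h
    exact h
  · obtain ⟨t, rfl⟩ := hl
    have h := (hL.isExtension μ hμi hi 0 (2 * t + 1)).opZ_blockK_neg μ hμk hi hk
      (mul_neg_one_pow_mul_self hδ _)
    have hs : -(δ * (-1) ^ (0 + (2 * t + 1))) = δ * (-1 : ℝ) ^ (0 + 2 * t) := by ring
    rw [hL.dirac_succ μ hμi hi, map_smul, map_smul, hs,
      hL.ladder_apply_zero μ hμi hi hB (even_two_mul t), map_zero, smul_zero,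
      neg_one_pow_add_even (even_two_mul t), pow_zero, mul_one] at h
    exact h

/-- The sign is opposite to the parity, so the restriction of `K F` is computed from `D q_j`, which
is zero. -/
theorem IsLadder.blockK_raise_zero (hL : IsLadder μ B i k g δ M q F) (hμi : 0 < μ i)
    (hμk : 0 < μ k) (hi : i ∉ B) (hk : k ∉ insert i B) (hδ : δ * δ = 1) (j : ℕ) :
    blockK V μ (δ * (-1) ^ (j + 1)) B i k (F j 0) = 0 := by
  refine hL.blockK_eq_zero μ hμk hk ?_
  have h := (hL.isExtension μ hμi hi j 0).opZ_blockK_neg μ hμk hi hk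
    (mul_neg_one_pow_mul_self hδ _)
  have hs : -(δ * (-1) ^ (j + 0)) = δ * (-1 : ℝ) ^ (j + 1) := by ring
  rw [pow_zero, Module.End.one_apply, hL.monogenic, map_zero, map_zero, hs] at h
  exact h

end Operators

section Operators

variable {n : ℕ} {V : Type*} [AddCommGroup V] [Module ℝ V] [Module (Cl n) V]
  [IsScalarTower ℝ (Cl n) V] (μ : Fin n → ℝ)

/-! ### The tower of extensions -/

/-- The tower of extensions started at the constant `w`, where the first step multiplies by
powers of `e₁ x₁` instead of `x₁`. -/
def cliffordTower (a : ℕ → ℕ) (w : V) : (m : ℕ) → m < n → VPoly n V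
  | 0, _ => 1 ⊗ₜ[ℝ] w
  | m + 1, h =>
      CK V μ ⟨m + 1, h⟩ (∑ i ∈ Finset.range (m + 1), a i)
        ((position V (Finset.Iio ⟨m + 1, h⟩) ^ a m) (cliffordTower a w m (by omega)))

theorem Iio_succ_eq_Iic {m : ℕ} (h : m + 1 < n) :
    Finset.Iio (⟨m + 1, h⟩ : Fin n) = Finset.Iic ⟨m, by omega⟩ := by
  ext t
  simp only [Finset.mem_Iio, Finset.mem_Iic, Fin.lt_def, Fin.le_def]
  omega

/-- The sum `∑_{i ∈ A} (μ_i + 1/2)`. -/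
def weightShift (A : Finset (Fin n)) : ℝ := ∑ i ∈ A, (μ i + 1 / 2)

/-- The stage `m` of the tower is monogenic in the variables up to `x_{m+1}`, homogeneous in
them, and independent of the others. -/
structure IsStage (a : ℕ → ℕ) (m : ℕ) (h : m < n) (Q : VPoly n V) : Prop where
  monogenic : dirac V μ (Finset.Iic ⟨m, h⟩) Q = 0
  weight : weightOp V μ (Finset.Iic ⟨m, h⟩) Q
    = (((∑ t ∈ Finset.range m, a t : ℕ) : ℝ) + weightShift μ (Finset.Iic ⟨m, h⟩)) • Q
  parity : opR V (Finset.Iic ⟨m, h⟩) Q = ((-1 : ℝ) ^ (∑ t ∈ Finset.range m, a t)) • Q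
  independent : ∀ t : Fin n, m < t → opZ V t Q = Q

theorem opZ_one_tmul (t : Fin n) (w : V) : opZ V t (1 ⊗ₜ[ℝ] w) = 1 ⊗ₜ[ℝ] w := by
  simp [opZ]

theorem weightOp_singleton_of_opZ {i : Fin n} {y : VPoly n V} (h : opZ V i y = y) :
    weightOp V μ {i} y = (μ i + 1 / 2) • y := by
  rw [weightOp, position_singleton, dirac_singleton, opET_mul_opEX_self]
  simp only [LinearMap.smul_apply, LinearMap.add_apply, LinearMap.sub_apply, Module.End.mul_apply,
    Module.End.one_apply, opET_eq_zero μ h, opR_eq_self h, map_zero]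
  module

theorem opZ_position_pow {A : Finset (Fin n)} {t : Fin n} (ht : t ∉ A) {y : VPoly n V}
    (hy : opZ V t y = y) (l : ℕ) :
    opZ V t ((position V A ^ l) y) = (position V A ^ l) y := by
  rw [← Module.End.mul_apply, ((opZ_commute_position V ht).pow_right l).eq, Module.End.mul_apply, hy]

variable {μ}

theorem isStage_CK (hμ : ∀ i, 0 < μ i) {a : ℕ → ℕ} {m : ℕ} {h : m + 1 < n} {Q : VPoly n V}
    (hQ : IsStage μ a m (by omega) Q) :
    IsStage μ a (m + 1) h (CK V μ ⟨m + 1, h⟩ (∑ i ∈ Finset.range (m + 1), a i)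
        ((position V (Finset.Iio ⟨m + 1, h⟩) ^ a m) Q)) ∧
    opZ V ⟨m + 1, h⟩ (CK V μ ⟨m + 1, h⟩ (∑ i ∈ Finset.range (m + 1), a i)
        ((position V (Finset.Iio ⟨m + 1, h⟩) ^ a m) Q))
      = (position V (Finset.Iio ⟨m + 1, h⟩) ^ a m) Q := by
  set i : Fin n := ⟨m + 1, h⟩ with hi
  have hni : i ∉ Finset.Iio i := by simp
  have hIio : Finset.Iio i = Finset.Iic ⟨m, by omega⟩ := Iio_succ_eq_Iic h
  set p := (position V (Finset.Iio i) ^ a m) Q with hp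
  set F := CK V μ i (∑ i ∈ Finset.range (m + 1), a i) p with hF
  obtain ⟨h1, h2, h3, h4⟩ := hQ
  rw [← hIio] at h1 h2 h3
  have hZ : opZ V i F = p :=
    opZ_CK μ (hμ i) _ (opZ_position_pow hni (h4 i (Nat.lt_succ_self m)) _)
  have hD : dirac V μ (Finset.Iic i) F = 0 := by
    -- The degree given to `CK` is at least `a m`, and `D` annihilates `x^(a m) Q` after `a m + 1`
    -- applications because `Q` is monogenic.
    refine dirac_CK μ (hμ i) _ (opZ_position_pow hni (h4 i (Nat.lt_succ_self m)) _)
      (dirac_pow_position_pow μ h1 h2 ?_)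
    rw [Finset.sum_range_succ]; omega
  rw [Iic_eq_insert_Iio] at hD
  refine ⟨⟨?_, ?_, ?_, ?_⟩, hZ⟩
  · rwa [Iic_eq_insert_Iio]
  · rw [Iic_eq_insert_Iio,
      weightOp_of_restriction μ (hμ i) hni hD hZ (weightOp_position_pow μ h2 (a m)),
      Finset.sum_range_succ, weightShift, weightShift, ← hi, Finset.sum_insert hni]
    congr 1
    push_cast
    ring
  · rw [Iic_eq_insert_Iio, opR_of_restriction μ (hμ i) hni hD hZ (opR_position_pow h3 (a m)),
      Finset.sum_range_succ, pow_add]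
  · intro t ht
    have ht' : t ∉ insert i (Finset.Iio i) := by
      rw [← Iic_eq_insert_Iio, Finset.mem_Iic, Fin.le_def]
      simp only [hi]
      omega
    -- Setting `x_t = 0` preserves monogenicity and fixes `p`, hence fixes its unique extension.
    refine (eigen_of_restriction μ (hμ i) hni (opZ_commute_dirac V μ ht') (opZ_comm V t i) hD hD
      (c := 1) ?_).trans (one_smul _ _)
    rw [hZ, one_smul]
    exact opZ_position_pow (fun h' => ht' (Finset.mem_insert_of_mem h')) (h4 t (by omega)) _

theorem isStage_cliffordTower (hμ : ∀ i, 0 < μ i) (a : ℕ → ℕ) (w : V) :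
    ∀ (m : ℕ) (h : m < n), IsStage μ a m h (cliffordTower μ a w m h)
  | 0, h => by
    have hz : Finset.Iic (⟨0, h⟩ : Fin n) = {⟨0, h⟩} := by
      ext t; simp [Fin.le_def, Fin.ext_iff]
    have hZ := opZ_one_tmul (⟨0, h⟩ : Fin n) w
    refine ⟨?_, ?_, ?_, fun t _ => opZ_one_tmul t w⟩
    · rw [hz, dirac_singleton]
      exact opET_eq_zero μ hZ
    · rw [hz, weightShift, Finset.sum_singleton, Finset.sum_range_zero, Nat.cast_zero, zero_add]
      exact weightOp_singleton_of_opZ μ hZ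
    · rw [hz, Finset.sum_range_zero, pow_zero, one_smul]
      exact opR_eq_self hZ
  | m + 1, h => (isStage_CK hμ (isStage_cliffordTower hμ a w m (by omega))).1

theorem opZ_cliffordTower (hμ : ∀ i, 0 < μ i) (a : ℕ → ℕ) (w : V) (m : ℕ) (h : m + 1 < n) :
    opZ V ⟨m + 1, h⟩ (cliffordTower μ a w (m + 1) h)
      = (position V (Finset.Iio ⟨m + 1, h⟩) ^ a m) (cliffordTower μ a w m (by omega)) :=
  (isStage_CK hμ (isStage_cliffordTower hμ a w m (by omega))).2

theorem dirac_cliffordTower (hμ : ∀ i, 0 < μ i) (a : ℕ → ℕ) (w : V) (m : ℕ) (h : m < n) :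
    dirac V μ (insert ⟨m, h⟩ (Finset.Iio ⟨m, h⟩)) (cliffordTower μ a w m h) = 0 := by
  rw [← Iic_eq_insert_Iio]
  exact (isStage_cliffordTower hμ a w m h).monogenic

theorem cliffordTower_congr {a b : ℕ → ℕ} (w : V) :
    ∀ (m : ℕ) (h : m < n), (∀ t < m, a t = b t) → cliffordTower μ a w m h = cliffordTower μ b w m h
  | 0, _, _ => rfl
  | m + 1, h, hab => by
    rw [cliffordTower, cliffordTower, cliffordTower_congr w m _ fun t ht => hab t (by omega),
      hab m (by omega), Finset.sum_congr rfl fun t ht => hab t (Finset.mem_range.mp ht)]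

theorem cliffordTower_smul (a : ℕ → ℕ) (s : ℝ) (w : V) :
    ∀ (m : ℕ) (h : m < n), cliffordTower μ a (s • w) m h = s • cliffordTower μ a w m h
  | 0, _ => TensorProduct.tmul_smul _ _ _
  | m + 1, h => by
    rw [cliffordTower, cliffordTower, cliffordTower_smul a s w m, map_smul, map_smul]

/-- Each later stage is the unique monogenic extension of a power of the position operator applied
to the previous stage, and `Θ` commutes with everything in this characterisation. -/
theorem cliffordTower_propagate (hμ : ∀ i, 0 < μ i) {Θ : Module.End ℝ (VPoly n V)} {a b : ℕ → ℕ}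
    {m : ℕ} (hab : ∀ t, m ≤ t → a t = b t) {w : V} {c : ℝ}
    (hΘ : ∀ i : Fin n, m < i → Commute Θ (dirac V μ (Finset.Iic i)) ∧ Commute Θ (opZ V i) ∧
      Commute Θ (position V (Finset.Iio i))) (hm : m < n)
    (h : Θ (cliffordTower μ a w m hm) = c • cliffordTower μ b w m hm) :
    ∀ N (hN : N < n), m ≤ N → Θ (cliffordTower μ a w N hN) = c • cliffordTower μ b w N hN := by
  intro N hN hmN
  induction N, hmN using Nat.le_induction with
  | base => exact h
  | succ N hmN ih =>
    obtain ⟨h1, h2, h3⟩ := hΘ ⟨N + 1, hN⟩ (Nat.lt_succ_of_le hmN)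
    rw [Iic_eq_insert_Iio] at h1
    refine eigen_of_restriction μ (hμ _) (by simp) h1 h2 (dirac_cliffordTower hμ _ _ _ _)
      (dirac_cliffordTower hμ _ _ _ _) ?_
    rw [opZ_cliffordTower hμ, opZ_cliffordTower hμ, ← Module.End.mul_apply,
      (h3.pow_right _).eq, Module.End.mul_apply, ih (by omega), map_smul, hab N hmN]

/-! ### The action of `K` on the tower -/

/-- The sequence `a` with the entries at `m` and `m + 1` replaced. -/
def setTwo (a : ℕ → ℕ) (m j l : ℕ) : ℕ → ℕ := fun t =>
  if t = m then j else if t = m + 1 then l else a t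

theorem K_eq_blockK (ε : ℤˣ) {m : ℕ} (h : m + 2 < n) :
    K V μ ε (m + 1) = blockK V μ ((ε : ℤ) : ℝ) (Finset.Iio ⟨m + 1, by omega⟩) ⟨m + 1, by omega⟩
      ⟨m + 2, h⟩ := by
  have h1 : lab n {m + 1 + 1, m + 1 + 2} = {⟨m + 1, by omega⟩, ⟨m + 2, h⟩} := by
    ext t; simp [lab, Fin.ext_iff]
  have h2 : lab n (Finset.Icc 1 (m + 1 + 2) \ {m + 1 + 1})
      = insert ⟨m + 2, h⟩ (Finset.Iio ⟨m + 1, by omega⟩) := by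
    ext t; simp only [lab, Finset.mem_filter, Finset.mem_univ, true_and, Finset.mem_sdiff, Finset.mem_Icc,
      Finset.mem_singleton, Finset.mem_insert, Finset.mem_Iio, Fin.ext_iff, Fin.lt_def]; omega
  have h3 : lab n (Finset.Icc 1 (m + 1 + 1))
      = insert ⟨m + 1, by omega⟩ (Finset.Iio ⟨m + 1, by omega⟩) := by
    ext t; simp only [lab, Finset.mem_filter, Finset.mem_univ, true_and, Finset.mem_Icc,
      Finset.mem_insert, Finset.mem_Iio, Fin.ext_iff, Fin.lt_def]; omega
  have h4 : lab n {m + 1 + 2} = {⟨m + 2, h⟩} := by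
    ext t; simp [lab, Fin.ext_iff]
  have h5 : lab n (Finset.Icc 1 (m + 1 + 2)) = insert ⟨m + 2, h⟩ (insert ⟨m + 1, by omega⟩
      (Finset.Iio ⟨m + 1, by omega⟩)) := by
    ext t; simp only [lab, Finset.mem_filter, Finset.mem_univ, true_and, Finset.mem_Icc,
      Finset.mem_insert, Finset.mem_Iio, Fin.ext_iff, Fin.lt_def]; omega
  have h6 : lab n (Finset.Icc 1 (m + 1)) = Finset.Iio ⟨m + 1, by omega⟩ := by
    ext t; simp [lab, Fin.lt_def]
  have h7 : lab n {m + 1 + 1} = {⟨m + 1, by omega⟩} := by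
    ext t; simp [lab, Fin.ext_iff]
  rw [K, blockK, h1, h2, h3, h4, h5, h6, h7]

theorem insert_insert_Iio {m : ℕ} (h : m + 2 < n) :
    insert (⟨m + 2, h⟩ : Fin n) (insert (⟨m + 1, by omega⟩ : Fin n)
      (Finset.Iio (⟨m + 1, by omega⟩ : Fin n))) = Finset.Iic ⟨m + 2, h⟩ := by
  rw [← Iic_eq_insert_Iio, ← Iio_succ_eq_Iic h, ← Iic_eq_insert_Iio]

theorem K_propagate (hμ : ∀ i, 0 < μ i) (ε : ℤˣ) {m : ℕ} (hm : m + 2 < n) {a b : ℕ → ℕ}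
    (hab : ∀ t, m + 2 ≤ t → a t = b t) {w : V} {c : ℝ}
    (h : blockK V μ ((ε : ℤ) : ℝ) (Finset.Iio ⟨m + 1, by omega⟩) ⟨m + 1, by omega⟩ ⟨m + 2, hm⟩
      (cliffordTower μ a w (m + 2) hm) = c • cliffordTower μ b w (m + 2) hm)
    (N : ℕ) (hN : N < n) (hmN : m + 2 ≤ N) :
    K V μ ε (m + 1) (cliffordTower μ a w N hN) = c • cliffordTower μ b w N hN := by
  rw [K_eq_blockK ε hm]
  refine cliffordTower_propagate hμ hab (fun i hi => ?_) hm h N hN hmN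
  have hsub : ∀ A ⊆ insert (⟨m + 2, hm⟩ : Fin n) (insert ⟨m + 1, by omega⟩
      (Finset.Iio ⟨m + 1, by omega⟩)), A ⊆ Finset.Iio i := by
    intro A hA t ht
    have := hA ht
    rw [insert_insert_Iio hm, Finset.mem_Iic] at this
    exact Finset.mem_Iio.mpr (lt_of_le_of_lt this hi)
  refine ⟨blockK_commute μ _ fun A hA => Gam_commute_dirac V μ ?_,
    blockK_commute μ _ fun A hA => (opZ_commute_Gam V μ fun h => ?_).symm,
    blockK_commute μ _ fun A hA => Gam_commute_position V μ (hsub A hA)⟩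
  · exact (hsub A hA).trans Finset.Iio_subset_Iic_self
  · exact lt_irrefl _ (Finset.mem_Iio.mp (hsub A hA h))

theorem isLadder_cliffordTower (hμ : ∀ i, 0 < μ i) (a : ℕ → ℕ) (w : V) {m : ℕ} (h : m + 2 < n) :
    IsLadder μ (Finset.Iio ⟨m + 1, by omega⟩) ⟨m + 1, by omega⟩ ⟨m + 2, h⟩
      (((∑ t ∈ Finset.range m, a t : ℕ) : ℝ) + weightShift μ (Finset.Iic ⟨m, by omega⟩))
      ((-1 : ℝ) ^ (∑ t ∈ Finset.range m, a t)) (cliffordTower μ a w m (by omega))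
      (fun j => cliffordTower μ (setTwo a m j 0) w (m + 1) (by omega))
      (fun j l => cliffordTower μ (setTwo a m j l) w (m + 2) h) where
  monogenic_base := by
    rw [Iio_succ_eq_Iic]; exact (isStage_cliffordTower hμ a w m (by omega)).monogenic
  weight := by
    rw [Iio_succ_eq_Iic]; exact (isStage_cliffordTower hμ a w m (by omega)).weight
  parity := by
    rw [Iio_succ_eq_Iic]; exact (isStage_cliffordTower hμ a w m (by omega)).parity
  monogenic j := dirac_cliffordTower hμ _ _ _ _
  restrict j := by
    rw [opZ_cliffordTower hμ,
      cliffordTower_congr (a := setTwo a m j 0) (b := a) w m _ fun t ht => ?_]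
    · simp [setTwo]
    · simp only [setTwo]; rw [if_neg (by omega), if_neg (by omega)]
  monogenic_top j l := by
    rw [insert_insert_Iio, Iic_eq_insert_Iio]
    exact dirac_cliffordTower hμ _ _ _ _
  restrict_top j l := by
    rw [opZ_cliffordTower hμ, ← Iic_eq_insert_Iio, Iio_succ_eq_Iic h,
      cliffordTower_congr (a := setTwo a m j l) (b := setTwo a m j 0) w (m + 1) _ fun t ht => ?_]
    · simp [setTwo]
    · simp only [setTwo]; split_ifs <;> first | rfl | omega

theorem half_lt_weight (hμ : ∀ i, 0 < μ i) (s : ℕ) (i : Fin n) :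
    1 / 2 < (s : ℝ) + weightShift μ (Finset.Iic i) := by
  have h1 : μ i + 1 / 2 ≤ weightShift μ (Finset.Iic i) :=
    Finset.single_le_sum (f := fun t => μ t + 1 / 2)
      (fun t _ => by have := hμ t; positivity) (Finset.mem_Iic.mpr le_rfl)
  have := hμ i
  have : (0 : ℝ) ≤ s := Nat.cast_nonneg s
  linarith

theorem setTwo_self {a : ℕ → ℕ} {m j l : ℕ} (hj : a m = j) (hl : a (m + 1) = l) :
    setTwo a m j l = a := by
  funext t
  simp only [setTwo]
  split_ifs with h1 h2
  · rw [h1, hj]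
  · rw [h2, hl]
  · rfl

theorem setTwo_of_le {a : ℕ → ℕ} {m j l t : ℕ} (ht : m + 2 ≤ t) : setTwo a m j l t = a t := by
  simp only [setTwo]; rw [if_neg (by omega), if_neg (by omega)]

variable (V)

theorem exists_K_lower (hμ : ∀ i, 0 < μ i) (ε : ℤˣ) (a : ℕ → ℕ) {m j l : ℕ} (h : m + 2 < n)
    (hj : a m = j + 1) (hl : a (m + 1) = l)
    (hε : ((ε : ℤ) : ℝ) = (-1) ^ (∑ t ∈ Finset.range (m + 1), a t)) :
    ∃ c : ℝ, c ≠ 0 ∧ ∀ (w : V) (N : ℕ) (hN : N < n), m + 2 ≤ N →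
      K V μ ε (m + 1) (cliffordTower μ a w N hN)
        = c • cliffordTower μ (setTwo a m j (l + 1)) w N hN := by
  obtain ⟨c, hc, hK⟩ := exists_blockK_lower (V := V) μ (Finset.Iio ⟨m + 1, by omega⟩)
    ⟨m + 1, by omega⟩ ⟨m + 2, h⟩
    (((∑ t ∈ Finset.range m, a t : ℕ) : ℝ) + weightShift μ (Finset.Iic ⟨m, by omega⟩))
    ((-1 : ℝ) ^ (∑ t ∈ Finset.range m, a t)) (hμ _) (hμ _) (by simp)
    (by simp) ⟨⟨0, by omega⟩, by simp [Fin.lt_def]⟩ (half_lt_weight hμ _ _)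
    (by rw [← pow_add, Even.neg_one_pow ⟨_, rfl⟩]) j l
  refine ⟨c, hc, fun w N hN hmN => K_propagate hμ ε h (fun t ht => (setTwo_of_le ht).symm) ?_
    N hN hmN⟩
  have := hK _ _ _ (isLadder_cliffordTower hμ a w h)
  rw [← pow_add, ← hj, ← Finset.sum_range_succ, ← hε, setTwo_self rfl hl] at this
  exact this

theorem exists_K_raise (hμ : ∀ i, 0 < μ i) (ε : ℤˣ) (a : ℕ → ℕ) {m j l : ℕ} (h : m + 2 < n)
    (hj : a m = j) (hl : a (m + 1) = l + 1)
    (hε : ((ε : ℤ) : ℝ) = -(-1) ^ (∑ t ∈ Finset.range (m + 1), a t)) :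
    ∃ c : ℝ, c ≠ 0 ∧ ∀ (w : V) (N : ℕ) (hN : N < n), m + 2 ≤ N →
      K V μ ε (m + 1) (cliffordTower μ a w N hN)
        = c • cliffordTower μ (setTwo a m (j + 1) l) w N hN := by
  obtain ⟨c, hc, hK⟩ := exists_blockK_raise (V := V) μ (Finset.Iio ⟨m + 1, by omega⟩)
    ⟨m + 1, by omega⟩ ⟨m + 2, h⟩
    (((∑ t ∈ Finset.range m, a t : ℕ) : ℝ) + weightShift μ (Finset.Iic ⟨m, by omega⟩))
    ((-1 : ℝ) ^ (∑ t ∈ Finset.range m, a t)) (hμ _) (hμ _) (by simp)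
    (by simp) ⟨⟨0, by omega⟩, by simp [Fin.lt_def]⟩ (half_lt_weight hμ _ _)
    (by rw [← pow_add, Even.neg_one_pow ⟨_, rfl⟩]) j l
  refine ⟨c, hc, fun w N hN hmN => K_propagate hμ ε h (fun t ht => (setTwo_of_le ht).symm) ?_
    N hN hmN⟩
  have := hK _ _ _ (isLadder_cliffordTower hμ a w h)
  rw [← pow_add, ← add_assoc, ← hj, ← Finset.sum_range_succ, pow_succ, mul_neg_one, ← hε,
    setTwo_self rfl hl, hj] at this
  exact this

variable {V}

theorem K_lower_zero (hμ : ∀ i, 0 < μ i) (ε : ℤˣ) (a : ℕ → ℕ) {m : ℕ} (h : m + 2 < n)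
    (hj : a m = 0) (hε : ((ε : ℤ) : ℝ) = (-1) ^ (∑ t ∈ Finset.range (m + 1), a t))
    (w : V) (N : ℕ) (hN : N < n) (hmN : m + 2 ≤ N) :
    K V μ ε (m + 1) (cliffordTower μ a w N hN) = 0 := by
  rw [K_propagate hμ ε h (b := a) (c := 0) (fun _ _ => rfl) ?_ N hN hmN, zero_smul]
  have := (isLadder_cliffordTower hμ a w h).blockK_lower_zero μ (hμ _) (hμ _) (by simp)
    (by simp) ⟨⟨0, by omega⟩, by simp [Fin.lt_def]⟩
    (by rw [← pow_add, Even.neg_one_pow ⟨_, rfl⟩]) (a (m + 1))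
  rw [Finset.sum_range_succ, hj, add_zero] at hε
  rw [hε, zero_smul]
  rwa [setTwo_self hj rfl] at this

theorem K_raise_zero (hμ : ∀ i, 0 < μ i) (ε : ℤˣ) (a : ℕ → ℕ) {m : ℕ} (h : m + 2 < n)
    (hl : a (m + 1) = 0) (hε : ((ε : ℤ) : ℝ) = -(-1) ^ (∑ t ∈ Finset.range (m + 1), a t))
    (w : V) (N : ℕ) (hN : N < n) (hmN : m + 2 ≤ N) :
    K V μ ε (m + 1) (cliffordTower μ a w N hN) = 0 := by
  rw [K_propagate hμ ε h (b := a) (c := 0) (fun _ _ => rfl) ?_ N hN hmN, zero_smul]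
  have := (isLadder_cliffordTower hμ a w h).blockK_raise_zero μ (hμ _) (hμ _) (by simp)
    (by simp) (by rw [← pow_add, Even.neg_one_pow ⟨_, rfl⟩]) (a m)
  rw [← pow_add, ← add_assoc, ← Finset.sum_range_succ, pow_succ, mul_neg_one, ← hε,
    setTwo_self rfl hl] at this
  rw [this, zero_smul]

/-! ### Comparison with the original tower -/

theorem opEX_pow_one_tmul (i : Fin n) (l : ℕ) (w : V) :
    (opEX V i ^ l) (1 ⊗ₜ[ℝ] w) = (X i ^ l) ⊗ₜ[ℝ] ((e i : Cl n) ^ l • w) := by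
  induction l with
  | zero => simp
  | succ l ih =>
    rw [pow_succ', Module.End.mul_apply, ih, opEX, opE, opX]
    simp [pow_succ', mul_smul]

theorem e_pow_mul_neg_pow (i : Fin n) (l : ℕ) : (e i : Cl n) ^ l * (-e i) ^ l = 1 := by
  rw [← (Commute.neg_right (Commute.refl (e i : Cl n))).mul_pow, mul_neg, e_mul_self, neg_neg,
    one_pow]

/-- The power `(e_1 x_1)^(a 0)` leaves `e_1^(a 0)` on the value, and `(-e_1)^(a 0)` is its inverse;
the two recursions then coincide. -/
theorem tower_succ (a : ℕ → ℕ) (v : V) :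
    ∀ (m : ℕ) (h : m + 1 < n), tower μ a v (m + 1) h
      = cliffordTower μ a (((-e ⟨0, by omega⟩ : Cl n) ^ a 0) • v) (m + 1) h
  | 0, h => by
    have hz : Finset.Iio (⟨0 + 1, h⟩ : Fin n) = {⟨0, by omega⟩} := by
      ext t; simp [Fin.lt_def, Fin.ext_iff]
    rw [tower, cliffordTower, hz, position_singleton, cliffordTower, opEX_pow_one_tmul, ← mul_smul,
      e_pow_mul_neg_pow, one_smul, tower, Finset.sum_range_one]
  | m + 1, h => by
    rw [tower, cliffordTower, tower_succ a v m (by omega)]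

end Operators

section Basis

variable {n : ℕ}

/-! ### Multi-indices -/

/-- The entry `j_{t+1}` of a multi-index as an integer. -/
def entryInt (k : ℕ) (j : Fin (n - 2) → ℤ) (t : ℕ) : ℤ :=
  if h : t < n - 2 then j ⟨t, h⟩ else k - ∑ m, j m

theorem entries_eq_toNat (k : ℕ) (j : Fin (n - 2) → ℤ) (t : ℕ) :
    entries k j t = (entryInt k j t).toNat := by
  simp only [entries, entryInt]
  split_ifs <;> rfl

theorem admissible_iff (hn : 3 ≤ n) (k : ℕ) (j : Fin (n - 2) → ℤ) :
    Admissible k j ↔ ∀ t < n - 1, 0 ≤ entryInt k j t := by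
  constructor
  · rintro ⟨h1, h2⟩ t _
    simp only [entryInt]
    split_ifs
    · exact h1 _
    · omega
  · intro h
    refine ⟨fun i => ?_, ?_⟩
    · have := h i (by omega)
      rwa [entryInt, dif_pos i.2] at this
    · have := h (n - 2) (by omega)
      rw [entryInt, dif_neg (lt_irrefl _)] at this
      omega

theorem cast_entries {k : ℕ} {j : Fin (n - 2) → ℤ} (hn : 3 ≤ n) (hj : Admissible k j) {t : ℕ}
    (ht : t < n - 1) : (entries k j t : ℤ) = entryInt k j t := by
  rw [entries_eq_toNat, Int.toNat_of_nonneg ((admissible_iff hn k j).mp hj t ht)]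

theorem partialSum_eq {k : ℕ} {j : Fin (n - 2) → ℤ} (hn : 3 ≤ n) (hj : Admissible k j) {ℓ : ℕ}
    (hℓ : ℓ ≤ n - 2) : partialSum j ℓ = ((∑ t ∈ Finset.range ℓ, entries k j t : ℕ) : ℤ) := by
  have h1 : ∀ i : Fin (n - 2), j i = (entries k j i : ℤ) := by
    intro i
    rw [cast_entries hn hj (by omega), entryInt, dif_pos i.2]
  rw [partialSum, Finset.sum_filter]
  simp only [h1]
  rw [Fin.sum_univ_eq_sum_range (fun t => if t < ℓ then (entries k j t : ℤ) else 0) (n - 2),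
    ← Finset.sum_filter, Nat.cast_sum]
  refine Finset.sum_congr ?_ fun _ _ => rfl
  ext t
  simp only [Finset.mem_filter, Finset.mem_range]
  omega

theorem entryInt_sub_hvec {k m : ℕ} (hm : m + 1 < n - 2) (j : Fin (n - 2) → ℤ) (η : ℤ) (t : ℕ) :
    entryInt k (j - η • hvec n (m + 1)) t
      = entryInt k j t + if t = m then -η else if t = m + 1 then η else 0 := by
  -- The entries `1` and `-1` cancel, so the dependent last entry does not move.
  have hsum : ∑ i, hvec n (m + 1) i = 0 := by
    have h1 : ∀ i : Fin (n - 2), hvec n (m + 1) i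
        = (if i = ⟨m, by omega⟩ then 1 else 0) - (if i = ⟨m + 1, hm⟩ then 1 else 0) := by
      intro i
      simp only [hvec, Fin.ext_iff]
      split_ifs <;> first | rfl | omega
    simp [h1]
  simp only [entryInt]
  split_ifs with h1 h2 h3 <;>
    simp only [Pi.sub_apply, Pi.smul_apply, smul_eq_mul, Finset.sum_sub_distrib, ← Finset.mul_sum,
      hsum]
  · rw [hvec, if_pos (by simp [h2])]; ring
  · rw [hvec, if_neg (by simp; omega), if_pos (by simp [h3])]; ring
  · rw [hvec, if_neg (by simp; omega), if_neg (by simp; omega)]; ring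
  · omega
  · omega
  · ring

theorem entryInt_sub_hbar {k m : ℕ} (hm : m + 1 = n - 2) (j : Fin (n - 2) → ℤ) (η : ℤ) {t : ℕ}
    (ht : t < n - 1) :
    entryInt k (j - η • hbar n) t
      = entryInt k j t + if t = m then -η else if t = m + 1 then η else 0 := by
  -- Total `1` makes the dependent last entry, at `m + 1`, absorb the change `η`.
  have hsum : ∑ i, hbar n i = 1 := by
    have h1 : ∀ i : Fin (n - 2), hbar n i = if i = ⟨m, by omega⟩ then 1 else 0 := by
      intro i
      simp only [hbar, Fin.ext_iff]
      split_ifs <;> first | rfl | omega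
    simp [h1]
  simp only [entryInt]
  split_ifs with h1 h2 h3 <;>
    simp only [Pi.sub_apply, Pi.smul_apply, smul_eq_mul, Finset.sum_sub_distrib, ← Finset.mul_sum,
      hsum]
  · rw [hbar, if_pos (by simp; omega)]; ring
  · omega
  · rw [hbar, if_neg (by simp; omega)]; ring
  · omega
  · ring
  · omega

/-! ### The action of `K` on the basis functions -/

variable {V : Type*} [AddCommGroup V] [Module ℝ V] [Module (Cl n) V] [IsScalarTower ℝ (Cl n) V]
  {μ : Fin n → ℝ}

theorem Psi_eq_cliffordTower (hn : 3 ≤ n) {k : ℕ} {j : Fin (n - 2) → ℤ} (hj : Admissible k j)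
    (v : V) : Psi hn μ k j v = cliffordTower μ (entries k j)
      (((-e ⟨0, by omega⟩ : Cl n) ^ entries k j 0) • v) (n - 1) (by omega) := by
  have h : ∀ (N : ℕ) (hN : N < n), 0 < N → tower μ (entries k j) v N hN
      = cliffordTower μ (entries k j) (((-e ⟨0, by omega⟩ : Cl n) ^ entries k j 0) • v) N hN := by
    rintro (_ | N) hN h0
    · exact absurd h0 (lt_irrefl 0)
    · exact tower_succ _ _ _ _
  rw [Psi, if_pos hj]
  exact h _ _ (by omega)

/-- Only a step at `m = 0` changes the power of `e_1`, by one; since `e_1² = -1`, the `e_1` in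
`twist` makes up for it up to a sign. -/
theorem exists_smul_twist (hn : 3 ≤ n) {m a b : ℕ} (h0 : m = 0 → a = b + 1 ∨ b = a + 1)
    (h1 : m ≠ 0 → a = b) : ∃ s : ℝ, s ≠ 0 ∧ ∀ v : V,
      ((-e ⟨0, by omega⟩ : Cl n) ^ a) • v
        = s • (((-e ⟨0, by omega⟩ : Cl n) ^ b) • twist hn (m + 1) v) := by
  by_cases hm : m = 0
  · rcases h0 hm with h | h
    · refine ⟨-1, by norm_num, fun v => ?_⟩
      rw [twist, if_pos (by omega), h, pow_succ, mul_smul, neg_smul, smul_neg, neg_one_smul]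
    · refine ⟨1, one_ne_zero, fun v => ?_⟩
      rw [twist, if_pos (by omega), h, pow_succ, one_smul, ← mul_smul, mul_assoc, neg_mul,
        e_mul_self, neg_neg, mul_one]
  · refine ⟨1, one_ne_zero, fun v => ?_⟩
    rw [twist, if_neg (by omega), h1 hm, one_smul]

theorem exists_K_Psi (hn : 3 ≤ n) (hμ : ∀ i, 0 < μ i) {k m : ℕ} (hm : m + 2 < n)
    {j J : Fin (n - 2) → ℤ} (hj : Admissible k j) (ε η : ℤˣ)
    (hη : ((ε : ℤ) : ℝ) = ((η : ℤ) : ℝ) * (-1) ^ (∑ t ∈ Finset.range (m + 1), entries k j t))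
    (hJ : ∀ t < n - 1, entryInt k J t
      = entryInt k j t + if t = m then -(η : ℤ) else if t = m + 1 then (η : ℤ) else 0) :
    ∃ c : ℝ, c ≠ 0 ∧ ∀ v : V,
      K V μ ε (m + 1) (Psi hn μ k j v) = c • Psi hn μ k J (twist hn (m + 1) v) := by
  have hcast : ∀ t < n - 1, (entries k j t : ℤ) = entryInt k j t := fun t ht =>
    cast_entries hn hj ht
  have hJm := hJ m (by omega)
  have hJm1 := hJ (m + 1) (by omega)
  rw [if_pos rfl, ← hcast m (by omega)] at hJm
  rw [if_neg (by omega), if_pos rfl, ← hcast (m + 1) (by omega)] at hJm1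
  have hzero : ¬ Admissible k J → (∀ (w : V) (N : ℕ) (hN : N < n), m + 2 ≤ N →
      K V μ ε (m + 1) (cliffordTower μ (entries k j) w N hN) = 0) → ∃ c : ℝ, c ≠ 0 ∧ ∀ v : V,
      K V μ ε (m + 1) (Psi hn μ k j v) = c • Psi hn μ k J (twist hn (m + 1) v) := by
    intro hnot hK
    -- Both sides vanish, so any nonzero constant serves.
    refine ⟨1, one_ne_zero, fun v => ?_⟩
    rw [Psi_eq_cliffordTower hn hj, hK _ _ _ (by omega), Psi, if_neg hnot, smul_zero]
  have hstep : ∀ (a' b' : ℕ), entryInt k J m = a' → entryInt k J (m + 1) = b' →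
      (entries k j m = a' + 1 ∨ a' = entries k j m + 1) →
      (∃ c : ℝ, c ≠ 0 ∧ ∀ (w : V) (N : ℕ) (hN : N < n), m + 2 ≤ N →
        K V μ ε (m + 1) (cliffordTower μ (entries k j) w N hN)
          = c • cliffordTower μ (setTwo (entries k j) m a' b') w N hN) →
      ∃ c : ℝ, c ≠ 0 ∧ ∀ v : V,
        K V μ ε (m + 1) (Psi hn μ k j v) = c • Psi hn μ k J (twist hn (m + 1) v) := by
    rintro a' b' ha' hb' hab ⟨c, hc, hK⟩
    have hset : ∀ t < n - 1, (setTwo (entries k j) m a' b' t : ℤ) = entryInt k J t := by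
      intro t ht
      simp only [setTwo]
      split_ifs with h1 h2
      · rw [h1, ha']
      · rw [h2, hb']
      · rw [hJ t ht, if_neg h1, if_neg h2, add_zero, hcast t ht]
    have hadm : Admissible k J :=
      (admissible_iff hn k J).mpr fun t ht => by rw [← hset t ht]; exact Int.natCast_nonneg _
    have hent : ∀ t < n - 1, setTwo (entries k j) m a' b' t = entries k J t := by
      intro t ht
      have := (hset t ht).trans (cast_entries hn hadm ht).symm
      exact_mod_cast this
    obtain ⟨s, hs, htw⟩ := exists_smul_twist (V := V) hn (m := m) (a := entries k j 0)
      (b := entries k J 0)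
      (by
        rintro rfl
        rw [← hent 0 (by omega)]
        simpa [setTwo] using hab)
      (by
        intro h0
        rw [← hent 0 (by omega)]
        simp only [setTwo]
        rw [if_neg (by omega), if_neg (by omega)])
    refine ⟨c * s, mul_ne_zero hc hs, fun v => ?_⟩
    rw [Psi_eq_cliffordTower hn hj, hK _ _ _ (by omega), htw, cliffordTower_smul,
      Psi_eq_cliffordTower hn hadm, cliffordTower_congr _ _ _ hent, smul_smul]
  -- `η = 1` lowers the entry at `m` and `η = -1` lowers the one at `m + 1`; if the entry to be
  -- lowered is `0`, the target is not admissible and `K` gives zero.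
  rcases Int.units_eq_one_or η with rfl | rfl
  · rw [Units.val_one] at hJm hJm1 hη
    rw [Int.cast_one, one_mul] at hη
    rcases h : entries k j m with _ | a'
    · refine hzero (fun hadm => ?_) fun w N hN hmN => K_lower_zero hμ ε _ hm h hη w N hN hmN
      have := (admissible_iff hn k J).mp hadm m (by omega)
      omega
    · exact hstep a' (entries k j (m + 1) + 1) (by omega) (by omega) (Or.inl h)
        (exists_K_lower V hμ ε _ hm h rfl hη)
  · rw [Units.val_neg, Units.val_one] at hJm hJm1 hη
    rw [Int.cast_neg, Int.cast_one, neg_one_mul] at hη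
    rcases h : entries k j (m + 1) with _ | b'
    · refine hzero (fun hadm => ?_) fun w N hN hmN => K_raise_zero hμ ε _ hm h hη w N hN hmN
      have := (admissible_iff hn k J).mp hadm (m + 1) (by omega)
      omega
    · exact hstep (entries k j m + 1) b' (by omega) (by omega) (Or.inr rfl)
        (exists_K_raise V hμ ε _ hm rfl h hη)

/-- Both parities of `|j_ℓ|` for a step direction `d` in the multi-indices. -/
theorem exists_K_Psi_of_direction (hn : 3 ≤ n) (hμ : ∀ i, 0 < μ i) {k m : ℕ} (hm : m + 2 < n)
    {j : Fin (n - 2) → ℤ} (hj : Admissible k j) (ε : ℤˣ) {d : Fin (n - 2) → ℤ}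
    (hd : ∀ (η : ℤ), ∀ t < n - 1, entryInt k (j - η • d) t
      = entryInt k j t + if t = m then -η else if t = m + 1 then η else 0) :
    ∃ c : ℝ, c ≠ 0 ∧ ∀ v : V,
      (Odd (partialSum j (m + 1)) →
        K V μ ε (m + 1) (Psi hn μ k j v)
          = c • Psi hn μ k (j + (ε : ℤ) • d) (twist hn (m + 1) v)) ∧
      (Even (partialSum j (m + 1)) →
        K V μ ε (m + 1) (Psi hn μ k j v)
          = c • Psi hn μ k (j - (ε : ℤ) • d) (twist hn (m + 1) v)) := by
  have hsum := partialSum_eq (k := k) hn hj (ℓ := m + 1) (by omega)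
  rw [hsum]
  simp only [Int.odd_coe_nat, Int.even_coe_nat]
  -- The step is `-η d` with `η = ε` for an even partial sum and `η = -ε` for an odd one.
  rcases Nat.even_or_odd (∑ t ∈ Finset.range (m + 1), entries k j t) with h | h
  · obtain ⟨c, hc, hK⟩ := exists_K_Psi (V := V) hn hμ hm hj ε ε (by rw [h.neg_one_pow, mul_one])
      (hd (ε : ℤ))
    exact ⟨c, hc, fun v => ⟨fun h' => absurd h (Nat.not_even_iff_odd.mpr h'), fun _ => hK v⟩⟩
  · obtain ⟨c, hc, hK⟩ := exists_K_Psi (V := V) hn hμ hm hj ε (-ε)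
      (by rw [h.neg_one_pow, Units.val_neg]; push_cast; ring) (hd ((-ε : ℤˣ) : ℤ))
    refine ⟨c, hc, fun v => ⟨fun _ => ?_, fun h' => absurd h' (Nat.not_even_iff_odd.mpr h)⟩⟩
    rw [hK v, Units.val_neg, neg_smul, sub_neg_eq_add]

end Basis

end DiracDunkl

end

/-! ### The steps `h_ℓ` and the last step `h̄_{n-2}` together. -/

theorem proposition11 (n k : ℕ) (hn : 3 ≤ n) (μ : Fin n → ℝ) (hμ : ∀ i, 0 < μ i)
    {V : Type*} [AddCommGroup V] [Module ℝ V] [Module (DiracDunkl.Cl n) V]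
    [IsScalarTower ℝ (DiracDunkl.Cl n) V]
    (j : Fin (n - 2) → ℤ) (hj : DiracDunkl.Admissible k j) (ε : ℤˣ) :
    (∀ ℓ : ℕ, 1 ≤ ℓ → ℓ ≤ n - 3 → ∃ c : ℝ, c ≠ 0 ∧ ∀ v : V,
      (Odd (DiracDunkl.partialSum j ℓ) →
        DiracDunkl.K V μ ε ℓ (DiracDunkl.Psi hn μ k j v) =
          c • DiracDunkl.Psi hn μ k (j + (ε : ℤ) • DiracDunkl.hvec n ℓ)
            (DiracDunkl.twist hn ℓ v)) ∧
      (Even (DiracDunkl.partialSum j ℓ) →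
        DiracDunkl.K V μ ε ℓ (DiracDunkl.Psi hn μ k j v) =
          c • DiracDunkl.Psi hn μ k (j - (ε : ℤ) • DiracDunkl.hvec n ℓ)
            (DiracDunkl.twist hn ℓ v))) ∧
    (∃ c : ℝ, c ≠ 0 ∧ ∀ v : V,
      (Odd (DiracDunkl.partialSum j (n - 2)) →
        DiracDunkl.K V μ ε (n - 2) (DiracDunkl.Psi hn μ k j v) =
          c • DiracDunkl.Psi hn μ k (j + (ε : ℤ) • DiracDunkl.hbar n)
            (DiracDunkl.twist hn (n - 2) v)) ∧
      (Even (DiracDunkl.partialSum j (n - 2)) →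
        DiracDunkl.K V μ ε (n - 2) (DiracDunkl.Psi hn μ k j v) =
          c • DiracDunkl.Psi hn μ k (j - (ε : ℤ) • DiracDunkl.hbar n)
            (DiracDunkl.twist hn (n - 2) v))) := by
  refine ⟨fun ℓ h1 h2 => ?_, ?_⟩
  · obtain ⟨m, rfl⟩ : ∃ m, ℓ = m + 1 := ⟨ℓ - 1, by omega⟩
    exact DiracDunkl.exists_K_Psi_of_direction hn hμ (by omega) hj ε fun η t _ =>
      DiracDunkl.entryInt_sub_hvec (by omega) j η t
  · obtain ⟨m, hm⟩ : ∃ m, n - 2 = m + 1 := ⟨n - 3, by omega⟩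
    have h := DiracDunkl.exists_K_Psi_of_direction (V := V) hn hμ (m := m) (by omega) hj ε
      fun η t ht => DiracDunkl.entryInt_sub_hbar hm.symm j η ht
    rw [← hm] at h
    exact h
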